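/- **Setting.** Let $n,m,d\ge 1$, and for $k\in\mathbb N_0=\{0,1,2,\dots\}$ let $A_k\in\mathbb R^{n\times n}$, $B_k\in\mathbb R^{n\times m}$, $Q_k\in\mathbb R^{n\times n}$ symmetric positive semidefinite and $R_k\in\mathbb R^{m\times m}$ symmetric positive definite. $M'$ is the transpose, $|\cdot|$ the Euclidean norm, $\|\cdot\|$ the induced matrix norm, $\lambda_{\min}(M)=\min_{|x|=1}x'Mx$ for symmetric $M$, and $C_k=Q_k^{1/2}$. Assume: 1. $\|A_k\|,\|B_k\|,\|Q_k\|,\|R_k\|$ are bounded uniformly in $k$; 2. every $A_k$ is non-singular; 3. with $\Theta_{k,j}=A_{k+j-1}\cdots A_k$, $\Theta_{k,0}=I$, for every $k$ the matrix $[\Theta_{k+1,d-1}B_k\ \ \Theta_{k+2,d-2}B_{k+1}\ \cdots\ \Theta_{k+d,0}B_{k+d-1}]$ has full row rank and the block column with entries $C_{k+j}\Theta_{k,j}$, $0\le j\le d$, has full column rank. For $t\in\mathbb N_0$ put $$\hat A_t=I_{n(d+1)}-\begin{bmatrix}0_{n,nd}&0_{n,n}\\ \mathrm{diag}(A_{dt},\dots,A_{d(t+1)-1})&0_{nd,n}\end{bmatrix},\quad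 \hat B_t=\begin{bmatrix}0_{n,md}\\ \mathrm{diag}(B_{dt},\dots,B_{d(t+1)-1})\end{bmatrix},\quad \hat C_t=\begin{bmatrix}\mathrm{diag}(C_{dt},\dots,C_{d(t+1)-1})&0_{nd,n}\end{bmatrix},$$ $E=\begin{bmatrix}I_n\\0_{nd,n}\end{bmatrix}$, $F=[0_{n,nd}\ \ I_n]$, $\Phi_t=F\hat A_t^{-1}E$, $\Gamma_t=F\hat A_t^{-1}\hat B_t$, $\Xi_t=\hat C_t\hat A_t^{-1}E$, $\Delta_t=\hat C_t\hat A_t^{-1}\hat B_t$, and $$\tilde R_t=\mathrm{diag}(R_{dt},\dots,R_{dt+d-1})+\Delta_t'\Delta_t,\quad \tilde Q_t=\Xi_t'\Xi_t-\Xi_t'\Delta_t\tilde R_t^{-1}\Delta_t'\Xi_t,\quad \tilde A_t=\Phi_t-\Gamma_t\tilde R_t^{-1}\Delta_t'\Xi_t,\quad \tilde B_t=\Gamma_t.$$ Assume also 4. $\inf_t\lambda_{\min}(\tilde Q_t)>0$, $\inf_t\lambda_{\min}(\tilde B_t\tilde B_t')>0$ and $\inf_t\lambda_{\min}(\tilde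 A_t\tilde A_t')>0$. For $N\in\mathbb N_0$ and inputs $w_t,\dots,w_{t+N-1}\in\mathbb R^{md}$ let $J_N(t,\chi,w)=\sum_{j=t}^{t+N-1}(z_j'\tilde Q_jz_j+w_j'\tilde R_jw_j)$, where $z_t=\chi$ and $z_{j+1}=\tilde A_jz_j+\tilde B_jw_j$. For an infinite input sequence $u$ let $J(0,\xi,u)=\lim_{N\to\infty}J_N(0,\xi,u_{[0:N-1]})$. The Riccati operator is $$\mathcal R_t(P)=\tilde Q_t+\tilde A_t'\bigl(P-P\tilde B_t(\tilde R_t+\tilde B_t'P\tilde B_t)^{-1}\tilde B_t'P\bigr)\tilde A_t .$$ Let $T\ge1$ be any horizon. The terminal penalties are $$X_{t+T}=\tilde Q_{t+T}+\tilde A_{t+T}'(\tilde B_{t+T}\tilde B_{t+T}')^{-1}\tilde B_{t+T}\tilde R_{t+T}\tilde B_{t+T}'(\tilde B_{t+T}\tilde B_{t+T}')^{-1}\tilde A_{t+T},\qquad t\in\mathbb N_0,$$ and the $T$-step receding-horizon policy assigns to $(t,x)$ the first entry of the minimizer $w=(w_t,\dots,w_{t+T-1})$ of $J_T(t,x,w)+z_{t+T}'X_{t+T}z_{t+T}$.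 Let $\hat X_{t+1}=\mathcal R_{t+1}\circ\cdots\circ\mathcal R_{t+T-1}(X_{t+T})$, $K_t=(\tilde R_t+\tilde B_t'\hat X_{t+1}\tilde B_t)^{-1}\tilde B_t'\hat X_{t+1}\tilde A_t$ and $$\overline\omega=\sup_t\|\mathcal R_t(\hat X_{t+1})\|,\quad \underline\omega=\inf_t\lambda_{\min}(\mathcal R_t(\hat X_{t+1})),\quad \underline\lambda=\inf_t\lambda_{\min}(\tilde Q_t+K_t'\tilde R_tK_t),\quad \overline\zeta=\sup_t\zeta_t,\quad \underline\epsilon=\inf_t\epsilon_t,$$ $$\zeta_t=\bigl\|(\tilde Q_t+\tilde Q_t\tilde A_t^{-1}\tilde B_t\tilde R_t^{-1}\tilde B_t'(\tilde A_t')^{-1}\tilde Q_t)^{-1}\bigr\|,\quad \epsilon_t=\lambda_{\min}\bigl(\tilde A_t^{-1}\tilde B_t(\tilde R_t+\tilde B_t'(\tilde A_t')^{-1}\tilde Q_t\tilde A_t^{-1}\tilde B_t)^{-1}\tilde B_t'(\tilde A_t')^{-1}\bigr).$$ **Theorem.** The recursion $P_t=\mathcal R_t(P_{t+1})$, $t\in\mathbb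 N_0$, has exactly one bounded positive semidefinite solution $(P_t)$. Put $\overline\lambda=\sup_t\|P_t\|$ and $\overline\delta=\sqrt n\,\log\bigl(\sup_t\|X_{t+T}\|/\lambda_{\min}(P_{t+T})\bigr)$. Each $X_{t+T}$ is positive definite and the minimizer that defines the receding-horizon policy exists and is unique. All $\zeta_t,\epsilon_t$ are positive, the suprema are finite, and $\overline\omega,\underline\omega,\underline\lambda,\overline\lambda,\overline\delta,\overline\zeta,\underline\epsilon$ are positive real numbers; in particular $\overline\zeta<\infty$, $\underline\epsilon>0$ and $\overline\zeta/(\overline\zeta+\underline\epsilon)<1$. For every $\xi\in\mathbb R^n$ let $\tilde u$ and $\tilde u^*$ be the inputs generated along $\tilde x_{t+1}=\tilde A_t\tilde x_t+\tilde B_t\tilde u_t$, $\tilde x_0=\xi$, by the receding-horizon policy and by the policy $\mu^*(t,x)=-(\tilde R_t+\tilde B_t'P_{t+1}\tilde B_t)^{-1}\tilde B_t'P_{t+1}\tilde A_tx$ respectively. Then $J(0,\xi,\tilde u)$ and $J(0,\xi,\tilde u^*)$ are finite, $\tilde u^*$ minimizes $J(0,\xi,\cdot)$ over all input sequences, and the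 performance loss $\beta(\xi)=J(0,\xi,\tilde u)-J(0,\xi,\tilde u^*)$ satisfies $$\beta(\xi)\le\frac{\overline\lambda}{\underline\lambda}\,\frac{\overline\omega}{\underline\omega}\,\overline\omega\left(\exp\left(\Bigl(\frac{\overline\zeta}{\overline\zeta+\underline\epsilon}\Bigr)^{T-1}\overline\delta\right)-1\right)|\xi|^2 .$$ -/

import Mathlib

open Matrix Filter Topology Set
open scoped Matrix.Norms.L2Operator MatrixOrder

noncomputable section

/-- Problem data `(A_k, B_k, Q_k, R_k)`, `k = 0, 1, 2, …`, of a non-stationary discrete-time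
linear-quadratic regulator problem with state dimension `n` and input dimension `m`. -/
structure LQRData (n m : ℕ) where
  A : ℕ → Matrix (Fin n) (Fin n) ℝ
  B : ℕ → Matrix (Fin n) (Fin m) ℝ
  Q : ℕ → Matrix (Fin n) (Fin n) ℝ
  R : ℕ → Matrix (Fin m) (Fin m) ℝ

/-- The least eigenvalue of a real symmetric matrix, as the minimum of `x' M x` over the
Euclidean unit sphere. -/
def lambdaMin {ι : Type} [Fintype ι] (M : Matrix ι ι ℝ) : ℝ :=
  ⨅ x : {x : ι → ℝ // x ⬝ᵥ x = 1}, x.1 ⬝ᵥ (M *ᵥ x.1)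

namespace LQRData

variable {n m : ℕ} (S : LQRData n m)

/-! ### The original problem data -/

/-- `C_k`, the positive semidefinite square root of `Q_k`. -/
def C (k : ℕ) : Matrix (Fin n) (Fin n) ℝ := CFC.sqrt (S.Q k)

/-- The state transition matrix `A_{k+j-1} ⋯ A_k` (the identity for `j = 0`). -/
def Theta (k : ℕ) : ℕ → Matrix (Fin n) (Fin n) ℝ
  | 0 => 1
  | j + 1 => S.A (k + j) * Theta k j

/-- The `d`-step controllability matrix; its `j`-th block column, `0 ≤ j < d`, is
`Θ_{k+j+1, d-1-j} B_{k+j}`. -/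
def ctrMatrix (d k : ℕ) : Matrix (Fin n) (Fin d × Fin m) ℝ :=
  Matrix.of fun a q => (S.Theta (k + q.1 + 1) (d - 1 - q.1) * S.B (k + q.1)) a q.2

/-- The `d`-step observability matrix; its `j`-th block row, `0 ≤ j ≤ d`, is
`C_{k+j} Θ_{k, j}`. -/
def obsMatrix (d k : ℕ) : Matrix (Fin (d + 1) × Fin n) (Fin n) ℝ :=
  Matrix.of fun p b => (S.C (k + p.1) * S.Theta k p.1) p.2 b

/-- The problem data are uniformly bounded (in the induced Euclidean norm). -/
def IsBounded : Prop :=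
  ∃ a b q r : ℝ, 0 < a ∧ 0 < b ∧ 0 < q ∧ 0 < r ∧
    ∀ k, ‖S.A k‖ ≤ a ∧ ‖S.B k‖ ≤ b ∧ ‖S.Q k‖ ≤ q ∧ ‖S.R k‖ ≤ r

/-- Every `d`-step controllability matrix has full row rank and every `d`-step observability
matrix has full column rank. -/
def IsCtrObs (d : ℕ) : Prop :=
  ∀ k, (S.ctrMatrix d k).rank = n ∧ (S.obsMatrix d k).rank = n

/-! ### The lifted problem data -/

/-- `Â_t`: the identity minus the matrix with the blocks `A_{dt}, …, A_{d(t+1)-1}` on the first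
block subdiagonal. -/
def Ahat (d t : ℕ) : Matrix (Fin (d + 1) × Fin n) (Fin (d + 1) × Fin n) ℝ :=
  1 - Matrix.of fun p q => if (p.1 : ℕ) = q.1 + 1 then S.A (d * t + q.1) p.2 q.2 else 0

/-- `B̂_t`: a zero block row on top of `diag(B_{dt}, …, B_{d(t+1)-1})`. -/
def Bhat (d t : ℕ) : Matrix (Fin (d + 1) × Fin n) (Fin d × Fin m) ℝ :=
  Matrix.of fun p q => if (p.1 : ℕ) = q.1 + 1 then S.B (d * t + q.1) p.2 q.2 else 0

/-- `Ĉ_t`: `diag(C_{dt}, …, C_{d(t+1)-1})` followed by a zero block column. -/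
def Chat (d t : ℕ) : Matrix (Fin d × Fin n) (Fin (d + 1) × Fin n) ℝ :=
  Matrix.of fun p q => if (p.1 : ℕ) = q.1 then S.C (d * t + p.1) p.2 q.2 else 0

/-- The block column `[I; 0; …; 0]`. -/
def firstBlock (n d : ℕ) : Matrix (Fin (d + 1) × Fin n) (Fin n) ℝ :=
  Matrix.of fun p b => if p = (0, b) then 1 else 0

/-- The block row `[0 ⋯ 0 I]`. -/
def lastBlock (n d : ℕ) : Matrix (Fin n) (Fin (d + 1) × Fin n) ℝ :=
  Matrix.of fun a q => if q = (Fin.last d, a) then 1 else 0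

/-- `diag(R_{dt}, …, R_{dt+d-1})`. -/
def Rdiag (d t : ℕ) : Matrix (Fin d × Fin m) (Fin d × Fin m) ℝ :=
  Matrix.of fun p q => if p.1 = q.1 then S.R (d * t + p.1) p.2 q.2 else 0

def Phi (d t : ℕ) : Matrix (Fin n) (Fin n) ℝ :=
  lastBlock n d * (S.Ahat d t)⁻¹ * firstBlock n d

def Gam (d t : ℕ) : Matrix (Fin n) (Fin d × Fin m) ℝ :=
  lastBlock n d * (S.Ahat d t)⁻¹ * S.Bhat d t

def Xi (d t : ℕ) : Matrix (Fin d × Fin n) (Fin n) ℝ :=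
  S.Chat d t * (S.Ahat d t)⁻¹ * firstBlock n d

def Del (d t : ℕ) : Matrix (Fin d × Fin n) (Fin d × Fin m) ℝ :=
  S.Chat d t * (S.Ahat d t)⁻¹ * S.Bhat d t

/-- `R̃_t`. -/
def Rt (d t : ℕ) : Matrix (Fin d × Fin m) (Fin d × Fin m) ℝ :=
  S.Rdiag d t + (S.Del d t)ᵀ * S.Del d t

/-- `Q̃_t`. -/
def Qt (d t : ℕ) : Matrix (Fin n) (Fin n) ℝ :=
  (S.Xi d t)ᵀ * S.Xi d t
    - (S.Xi d t)ᵀ * S.Del d t * (S.Rt d t)⁻¹ * (S.Del d t)ᵀ * S.Xi d t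

/-- `Ã_t`. -/
def At (d t : ℕ) : Matrix (Fin n) (Fin n) ℝ :=
  S.Phi d t - S.Gam d t * (S.Rt d t)⁻¹ * (S.Del d t)ᵀ * S.Xi d t

/-- `B̃_t`. -/
def Bt (d t : ℕ) : Matrix (Fin n) (Fin d × Fin m) ℝ := S.Gam d t

/-- Uniformity: the least eigenvalues of `Q̃_t`, `B̃_t B̃_t'` and `Ã_t Ã_t'` are bounded away from
zero. -/
def IsUniform (d : ℕ) : Prop :=
  0 < ⨅ t, lambdaMin (S.Qt d t) ∧
  0 < ⨅ t, lambdaMin (S.Bt d t * (S.Bt d t)ᵀ) ∧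
  0 < ⨅ t, lambdaMin (S.At d t * (S.At d t)ᵀ)

/-! ### Costs -/

/-- The state at time `t + i` of the lifted system `z_{j+1} = Ã_j z_j + B̃_j w_j` started from
`z_t = χ`, where `w i` is the input applied at time `t + i`. -/
def traj (d t : ℕ) (χ : Fin n → ℝ) (w : ℕ → Fin d × Fin m → ℝ) : ℕ → Fin n → ℝ
  | 0 => χ
  | i + 1 => S.At d (t + i) *ᵥ traj d t χ w i + S.Bt d (t + i) *ᵥ w i

/-- An input sequence of length `T`, continued by zero. -/
def extend {d T : ℕ} (w : Fin T → Fin d × Fin m → ℝ) (i : ℕ) : Fin d × Fin m → ℝ :=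
  if h : i < T then w ⟨i, h⟩ else 0

/-- The finite-horizon cost `J_T(t, χ, w)`. -/
def cost (d T t : ℕ) (χ : Fin n → ℝ) (w : Fin T → Fin d × Fin m → ℝ) : ℝ :=
  ∑ i : Fin T,
    (S.traj d t χ (extend w) i ⬝ᵥ (S.Qt d (t + i) *ᵥ S.traj d t χ (extend w) i)
      + w i ⬝ᵥ (S.Rt d (t + i) *ᵥ w i))

/-- `L_T(t, χ, w, X)`: the finite-horizon cost with terminal penalty matrix `X`. -/
def costTerm (d T t : ℕ) (χ : Fin n → ℝ) (w : Fin T → Fin d × Fin m → ℝ)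
    (X : Matrix (Fin n) (Fin n) ℝ) : ℝ :=
  S.cost d T t χ w + S.traj d t χ (extend w) T ⬝ᵥ (X *ᵥ S.traj d t χ (extend w) T)

/-- The cost `J_N(t, χ, u_{[t : t+N-1]})` of the first `N` stages from time `t` under the infinite
input sequence `u`. -/
def partialCost (d t : ℕ) (χ : Fin n → ℝ) (u : ℕ → Fin d × Fin m → ℝ) (N : ℕ) : ℝ :=
  S.cost d N t χ fun i => u (t + i)

/-- The infinite-horizon cost `J(t, χ, u)`, the limit of `J_N` as `N → ∞` (meaningful when this
limit exists in `ℝ`). -/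
def infCost (d t : ℕ) (χ : Fin n → ℝ) (u : ℕ → Fin d × Fin m → ℝ) : ℝ :=
  limUnder atTop (S.partialCost d t χ u)

/-! ### Riccati operator and policies -/

/-- The Riccati operator `ℛ_t`. -/
def ric (d t : ℕ) (P : Matrix (Fin n) (Fin n) ℝ) : Matrix (Fin n) (Fin n) ℝ :=
  S.Qt d t + (S.At d t)ᵀ *
    (P - P * S.Bt d t * (S.Rt d t + (S.Bt d t)ᵀ * P * S.Bt d t)⁻¹ * (S.Bt d t)ᵀ * P) * S.At d t

/-- The composition `ℛ_t ∘ ℛ_{t+1} ∘ ⋯ ∘ ℛ_{t+k-1}` (the identity for `k = 0`). -/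
def ricIter (d : ℕ) : ℕ → ℕ → Matrix (Fin n) (Fin n) ℝ → Matrix (Fin n) (Fin n) ℝ
  | _, 0, X => X
  | t, k + 1, X => S.ric d t (ricIter d (t + 1) k X)

/-- `P` is a bounded positive semidefinite solution of the backward recursion
`P_t = ℛ_t(P_{t+1})`. -/
def IsRiccatiSolution (d : ℕ) (P : ℕ → Matrix (Fin n) (Fin n) ℝ) : Prop :=
  (∀ t, (P t).PosSemidef) ∧ BddAbove (range fun t => ‖P t‖) ∧ ∀ t, P t = S.ric d t (P (t + 1))

/-- The feedback gain `(R̃_t + B̃_t' Y B̃_t)⁻¹ B̃_t' Y Ã_t`. -/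
def gain (d t : ℕ) (Y : Matrix (Fin n) (Fin n) ℝ) : Matrix (Fin d × Fin m) (Fin n) ℝ :=
  (S.Rt d t + (S.Bt d t)ᵀ * Y * S.Bt d t)⁻¹ * (S.Bt d t)ᵀ * Y * S.At d t

/-- The optimal policy `μ*(t, x) = -(R̃_t + B̃_t' P_{t+1} B̃_t)⁻¹ B̃_t' P_{t+1} Ã_t x`. -/
def optPolicy (d : ℕ) (P : ℕ → Matrix (Fin n) (Fin n) ℝ) (t : ℕ) (x : Fin n → ℝ) :
    Fin d × Fin m → ℝ :=
  -(S.gain d t (P (t + 1)) *ᵥ x)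

/-- The state of the lifted system at time `t` under the state-feedback policy `μ`, started from
`ξ` at time `0`. -/
def clState (d : ℕ) (μ : ℕ → (Fin n → ℝ) → Fin d × Fin m → ℝ) (ξ : Fin n → ℝ) : ℕ → Fin n → ℝ
  | 0 => ξ
  | t + 1 => S.At d t *ᵥ clState d μ ξ t + S.Bt d t *ᵥ μ t (clState d μ ξ t)

/-- The input sequence generated from the initial state `ξ` by the state-feedback policy `μ`. -/
def clInput (d : ℕ) (μ : ℕ → (Fin n → ℝ) → Fin d × Fin m → ℝ) (ξ : Fin n → ℝ) (t : ℕ) :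
    Fin d × Fin m → ℝ :=
  μ t (S.clState d μ ξ t)

/-- `w` minimizes `L_T(t, χ, ·, X)`. -/
def IsArgmin (d T t : ℕ) (χ : Fin n → ℝ) (X : Matrix (Fin n) (Fin n) ℝ)
    (w : Fin T → Fin d × Fin m → ℝ) : Prop :=
  ∀ w' : Fin T → Fin d × Fin m → ℝ, S.costTerm d T t χ w X ≤ S.costTerm d T t χ w' X

/-- `μ` is the `T`-step receding-horizon policy for the terminal penalties `X_{t+T}`: `μ(t, x)` is
the first entry of a minimizer of `L_T(t, x, ·, X_{t+T})`. -/
def IsRHPolicy (d T : ℕ) (X : ℕ → Matrix (Fin n) (Fin n) ℝ)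
    (μ : ℕ → (Fin n → ℝ) → Fin d × Fin m → ℝ) : Prop :=
  ∀ t x, ∃ w : Fin T → Fin d × Fin m → ℝ,
    S.IsArgmin d T t x (X (t + T)) w ∧ μ t x = extend w 0

/-- The performance loss `β(ξ) = J(0, ξ, ũ) - J(0, ξ, ũ*)` of the policy `μ`, where `ũ*` is
generated by the optimal policy. -/
def perfLoss (d : ℕ) (P : ℕ → Matrix (Fin n) (Fin n) ℝ)
    (μ : ℕ → (Fin n → ℝ) → Fin d × Fin m → ℝ) (ξ : Fin n → ℝ) : ℝ :=
  S.infCost d 0 ξ (S.clInput d μ ξ) - S.infCost d 0 ξ (S.clInput d (S.optPolicy d P) ξ)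

/-! ### The terminal penalties and the constants of the bound -/

/-- The explicit terminal penalty
`X_s = Q̃_s + Ã_s' (B̃_s B̃_s')⁻¹ B̃_s R̃_s B̃_s' (B̃_s B̃_s')⁻¹ Ã_s`. -/
def termPen (d s : ℕ) : Matrix (Fin n) (Fin n) ℝ :=
  S.Qt d s + (S.At d s)ᵀ * (S.Bt d s * (S.Bt d s)ᵀ)⁻¹ * S.Bt d s * S.Rt d s
    * (S.Bt d s)ᵀ * (S.Bt d s * (S.Bt d s)ᵀ)⁻¹ * S.At d s

/-- `X̂_{t+1} = ℛ_{t+1} ∘ ⋯ ∘ ℛ_{t+T-1}(X_{t+T})` for `T ≥ 1`. -/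
def XhatSucc (d T t : ℕ) : Matrix (Fin n) (Fin n) ℝ :=
  S.ricIter d (t + 1) (T - 1) (S.termPen d (t + T))

/-- `ω̄`. -/
def omegaSup (d T : ℕ) : ℝ := ⨆ t, ‖S.ric d t (S.XhatSucc d T t)‖

/-- `ω̲`. -/
def omegaInf (d T : ℕ) : ℝ := ⨅ t, lambdaMin (S.ric d t (S.XhatSucc d T t))

/-- `λ̲`, with `K_t` the gain that belongs to `X̂_{t+1}`. -/
def lamInf (d T : ℕ) : ℝ :=
  ⨅ t, lambdaMin (S.Qt d t
    + (S.gain d t (S.XhatSucc d T t))ᵀ * S.Rt d t * S.gain d t (S.XhatSucc d T t))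

/-- `λ̄ = sup_t ‖P_t‖`. -/
def lamSup (P : ℕ → Matrix (Fin n) (Fin n) ℝ) : ℝ := ⨆ t, ‖P t‖

/-- `‖X_{t+T}‖ / λ_min(P_{t+T})`. -/
def deltaRatio (d T : ℕ) (P : ℕ → Matrix (Fin n) (Fin n) ℝ) (t : ℕ) : ℝ :=
  ‖S.termPen d (t + T)‖ / lambdaMin (P (t + T))

/-- `δ̄`. -/
def deltaSup (d T : ℕ) (P : ℕ → Matrix (Fin n) (Fin n) ℝ) : ℝ :=
  Real.sqrt n * Real.log (⨆ t, S.deltaRatio d T P t)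

/-- `ζ_t`. -/
def zeta (d t : ℕ) : ℝ :=
  ‖(S.Qt d t + S.Qt d t * (S.At d t)⁻¹ * S.Bt d t * (S.Rt d t)⁻¹ * (S.Bt d t)ᵀ
    * ((S.At d t)ᵀ)⁻¹ * S.Qt d t)⁻¹‖

/-- `ε_t`. -/
def eps (d t : ℕ) : ℝ :=
  lambdaMin ((S.At d t)⁻¹ * S.Bt d t
    * (S.Rt d t + (S.Bt d t)ᵀ * ((S.At d t)ᵀ)⁻¹ * S.Qt d t * (S.At d t)⁻¹ * S.Bt d t)⁻¹
    * (S.Bt d t)ᵀ * ((S.At d t)ᵀ)⁻¹)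

/-- `ζ̄ = sup_t ζ_t`. -/
def zetaSup (d : ℕ) : ℝ := ⨆ t, S.zeta d t

/-- `ε̲ = inf_t ε_t`. -/
def epsInf (d : ℕ) : ℝ := ⨅ t, S.eps d t

end LQRData

end

/-!
Two facts about one stage of the Riccati recursion carry the proof. Completing the square
(`Matrix.riccati_complete_square`) identifies `x' ℛ_t(P) x` with the least value of stage cost plus
cost-to-go `P`; in particular `ℛ_t` is monotone, and comparison with the input that steers the state
to zero in one step gives `ℛ_t(P) ≤ X_t` for every `P ≥ 0`, where `X_t` is the terminal penalty
(`Matrix.riccati_le_deadbeat`). Secondly, `ℛ_t` contracts the Thompson metric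
(`Matrix.riccati_le_exp_smul`): if `P' ≤ e^δ P`, then `ℛ_t(P') ≤ e^{ρ δ} ℛ_t(P)` with
`ρ = ζ̄ / (ζ̄ + ε̲)`. The reason is that `ℛ_t(P)⁻¹` is a concave function of `P⁻¹`, with values between
two matrices whose difference is controlled by `ζ_t` and the smaller of which is bounded below by
`ε_t`.

Since `ℛ_t(P) ≤ X_t`, value iteration started at the terminal penalties decreases with the horizon.
Its limit is a bounded solution `P` of the recursion, and the contraction makes it the only one.
The same monotonicity shows that `x' ℛ_t(X̂_{t+1}) x` decreases along the receding-horizon policy by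
at least the stage cost, so that the policy costs at most `ξ' ℛ_0(X̂_1) ξ`, while the optimal cost
is `ξ' P_0 ξ`. Contraction over the horizon bounds `ℛ_0(X̂_1)` by `exp(ρ^T δ) P_0` with
`δ = log sup ‖X‖ / λ_min(P) ≤ δ̄`. Hence the loss is at most `λ̄ (exp(ρ^{T-1} δ̄) - 1) |ξ|²`, and the
other factors in the bound are at least `1`.

The finiteness and positivity of the constants needs an upper bound on `‖Ã_t‖`. As the `R_k` need
not be uniformly positive definite, the gains inside `Ã_t` may be unbounded; but the determinant is
bounded, because the block triangular structure of the lifted matrices gives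
`det R̃_t det Ã_t = det Φ_t det R_t` with `R_t ≤ R̃_t` (`LQRData.det_At_mul_det_Rt`). Together with the
bound on `‖Ã_t⁻¹‖` this bounds `‖Ã_t‖` (`Matrix.UniformlyBounded.of_inv_of_det`).
-/

set_option linter.unusedSectionVars false

/-! ### Real quadratic forms and the Loewner order -/

namespace Matrix

section QuadraticForms

variable {ι κ : Type*} [Fintype ι] [Fintype κ]

lemma transpose_eq_of_isHermitian {M : Matrix ι ι ℝ} (h : M.IsHermitian) : Mᵀ = M := by
  rw [← conjTranspose_eq_transpose_of_trivial]; exact h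

lemma isHermitian_of_transpose_eq {M : Matrix ι ι ℝ} (h : Mᵀ = M) : M.IsHermitian := by
  rw [IsHermitian, conjTranspose_eq_transpose_of_trivial]; exact h

lemma dotProduct_mulVec_comm {M : Matrix ι ι ℝ} (h : M.IsHermitian) (x y : ι → ℝ) :
    x ⬝ᵥ (M *ᵥ y) = y ⬝ᵥ (M *ᵥ x) := by
  conv_lhs => rw [← transpose_eq_of_isHermitian h, dotProduct_transpose_mulVec]

lemma quad_conj (M : Matrix ι κ ℝ) (P : Matrix ι ι ℝ) (x : κ → ℝ) :
    x ⬝ᵥ ((Mᵀ * P * M) *ᵥ x) = (M *ᵥ x) ⬝ᵥ (P *ᵥ (M *ᵥ x)) := by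
  rw [← mulVec_mulVec, ← mulVec_mulVec, dotProduct_transpose_mulVec, dotProduct_comm]

lemma PosSemidef.quad_nonneg {M : Matrix ι ι ℝ} (h : M.PosSemidef) (x : ι → ℝ) :
    0 ≤ x ⬝ᵥ (M *ᵥ x) := by
  simpa using h.dotProduct_mulVec_nonneg x

lemma PosDef.quad_pos {M : Matrix ι ι ℝ} (h : M.PosDef) {x : ι → ℝ} (hx : x ≠ 0) :
    0 < x ⬝ᵥ (M *ᵥ x) := by
  simpa using h.dotProduct_mulVec_pos hx

lemma posSemidef_of_quad {M : Matrix ι ι ℝ} (h : M.IsHermitian)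
    (h' : ∀ x : ι → ℝ, 0 ≤ x ⬝ᵥ (M *ᵥ x)) : M.PosSemidef :=
  .of_dotProduct_mulVec_nonneg h (by simpa using h')

lemma posDef_of_quad {M : Matrix ι ι ℝ} (h : M.IsHermitian)
    (h' : ∀ x : ι → ℝ, x ≠ 0 → 0 < x ⬝ᵥ (M *ᵥ x)) : M.PosDef :=
  .of_dotProduct_mulVec_pos h (by simpa using h')

lemma posSemidef_conj {P : Matrix ι ι ℝ} (hP : P.PosSemidef) (M : Matrix ι κ ℝ) :
    (Mᵀ * P * M).PosSemidef := by
  simpa using hP.conjTranspose_mul_mul_same M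

lemma posSemidef_conj' {P : Matrix κ κ ℝ} (hP : P.PosSemidef) (M : Matrix ι κ ℝ) :
    (M * P * Mᵀ).PosSemidef := by
  simpa using hP.mul_mul_conjTranspose_same M

lemma quad_sq (M : Matrix ι κ ℝ) (x : κ → ℝ) :
    x ⬝ᵥ ((Mᵀ * M) *ᵥ x) = (M *ᵥ x) ⬝ᵥ (M *ᵥ x) := by
  rw [← mulVec_mulVec, dotProduct_transpose_mulVec]

lemma posSemidef_transpose_mul_self (M : Matrix ι κ ℝ) : (Mᵀ * M).PosSemidef := by
  simpa using posSemidef_conjTranspose_mul_self M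

lemma quad_mono {A B : Matrix ι ι ℝ} (h : A ≤ B) (x : ι → ℝ) :
    x ⬝ᵥ (A *ᵥ x) ≤ x ⬝ᵥ (B *ᵥ x) := by
  have := (le_iff.1 h).quad_nonneg x
  rw [sub_mulVec, dotProduct_sub] at this
  linarith

lemma le_of_quad {A B : Matrix ι ι ℝ} (hA : A.IsHermitian) (hB : B.IsHermitian)
    (h : ∀ x : ι → ℝ, x ⬝ᵥ (A *ᵥ x) ≤ x ⬝ᵥ (B *ᵥ x)) : A ≤ B := by
  refine le_iff.2 (posSemidef_of_quad (hB.sub hA) fun x => ?_)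
  rw [sub_mulVec, dotProduct_sub]
  linarith [h x]

lemma quad_smul (c : ℝ) (A : Matrix ι ι ℝ) (x : ι → ℝ) :
    x ⬝ᵥ ((c • A) *ᵥ x) = c * (x ⬝ᵥ (A *ᵥ x)) := by
  rw [smul_mulVec, dotProduct_smul, smul_eq_mul]

lemma isHermitian_smul {A : Matrix ι ι ℝ} (hA : A.IsHermitian) (c : ℝ) :
    (c • A).IsHermitian := by
  refine isHermitian_of_transpose_eq ?_
  rw [transpose_smul, transpose_eq_of_isHermitian hA]

lemma PosDef.of_le {A B : Matrix ι ι ℝ} (hA : A.PosDef) (h : A ≤ B) : B.PosDef := by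
  have := hA.add_posSemidef (le_iff.1 h)
  rwa [add_sub_cancel] at this

lemma posDef_of_quad_ge {M : Matrix ι ι ℝ} (h : M.IsHermitian) {c : ℝ} (hc : 0 < c)
    (h' : ∀ x : ι → ℝ, c * (x ⬝ᵥ x) ≤ x ⬝ᵥ (M *ᵥ x)) : M.PosDef := by
  refine posDef_of_quad h fun x hx => lt_of_lt_of_le (mul_pos hc ?_) (h' x)
  simpa using dotProduct_star_self_pos_iff.2 hx

lemma dotProduct_self_nonneg' (x : ι → ℝ) : 0 ≤ x ⬝ᵥ x := by
  simpa using dotProduct_star_self_nonneg x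

end QuadraticForms

section Inverse

variable {ι κ : Type*} [Fintype ι] [Fintype κ] [DecidableEq ι] [DecidableEq κ]

/-- Half of the variational formula `x' M⁻¹ x = max_y (2 x' y - y' M y)`. The maximum is attained
at `y = M⁻¹ x`, see `quad_inv_eq`. -/
lemma PosDef.le_quad_inv {M : Matrix ι ι ℝ} (hM : M.PosDef) (x y : ι → ℝ) :
    2 * (x ⬝ᵥ y) - y ⬝ᵥ (M *ᵥ y) ≤ x ⬝ᵥ (M⁻¹ *ᵥ x) := by
  have hdet : IsUnit M.det := (isUnit_iff_isUnit_det _).1 hM.isUnit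
  have h := hM.posSemidef.quad_nonneg (y - M⁻¹ *ᵥ x)
  have e : M *ᵥ (M⁻¹ *ᵥ x) = x := by rw [mulVec_mulVec, mul_nonsing_inv _ hdet, one_mulVec]
  have e2 : (M⁻¹ *ᵥ x) ⬝ᵥ (M *ᵥ y) = x ⬝ᵥ y := by
    rw [dotProduct_mulVec_comm hM.isHermitian, e, dotProduct_comm]
  rw [mulVec_sub, e, sub_dotProduct, dotProduct_sub, dotProduct_sub, e2,
    dotProduct_comm (M⁻¹ *ᵥ x) x, dotProduct_comm y x] at h
  linarith

lemma PosDef.quad_inv_eq {M : Matrix ι ι ℝ} (hM : M.PosDef) (x : ι → ℝ) :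
    2 * (x ⬝ᵥ (M⁻¹ *ᵥ x)) - (M⁻¹ *ᵥ x) ⬝ᵥ (M *ᵥ (M⁻¹ *ᵥ x)) = x ⬝ᵥ (M⁻¹ *ᵥ x) := by
  have hdet : IsUnit M.det := (isUnit_iff_isUnit_det _).1 hM.isUnit
  rw [mulVec_mulVec, mul_nonsing_inv _ hdet, one_mulVec, dotProduct_comm (M⁻¹ *ᵥ x) x]
  ring

/-- Inversion is convex and antitone on positive definite matrices, in one statement. -/
lemma PosDef.inv_le_convex_comb {L M N : Matrix ι ι ℝ} (hL : L.PosDef) (hM : M.PosDef)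
    (hN : N.PosDef) {a b : ℝ} (ha : 0 ≤ a) (hb : 0 ≤ b) (hab : a + b = 1)
    (h : a • M + b • N ≤ L) : L⁻¹ ≤ a • M⁻¹ + b • N⁻¹ := by
  refine le_of_quad hL.inv.isHermitian ((isHermitian_smul hM.inv.isHermitian _).add
    (isHermitian_smul hN.inv.isHermitian _)) fun x => ?_
  have h1 := mul_le_mul_of_nonneg_left (hM.le_quad_inv x (L⁻¹ *ᵥ x)) ha
  have h2 := mul_le_mul_of_nonneg_left (hN.le_quad_inv x (L⁻¹ *ᵥ x)) hb
  have h3 := quad_mono h (L⁻¹ *ᵥ x)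
  rw [← hL.quad_inv_eq x]
  rw [add_mulVec, dotProduct_add, quad_smul, quad_smul] at h3 ⊢
  obtain rfl : a = 1 - b := by linarith
  linarith

lemma PosDef.inv_anti {M N : Matrix ι ι ℝ} (hM : M.PosDef) (h : M ≤ N) : N⁻¹ ≤ M⁻¹ := by
  simpa using (hM.of_le h).inv_le_convex_comb hM hM zero_le_one le_rfl (add_zero 1) (by simpa using h)

lemma inv_smul_real (M : Matrix ι ι ℝ) {c : ℝ} (hM : IsUnit M) (hc : c ≠ 0) :
    (c • M)⁻¹ = c⁻¹ • M⁻¹ := by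
  refine inv_eq_left_inv ?_
  rw [smul_mul_smul_comm, inv_mul_cancel₀ hc, nonsing_inv_mul _ ((isUnit_iff_isUnit_det _).1 hM),
    one_smul]

/-- The determinant is monotone when a positive definite matrix is increased by `Δ' Δ`. -/
lemma PosDef.det_le_det_add {R : Matrix κ κ ℝ} (hR : R.PosDef) (D : Matrix ι κ ℝ) :
    R.det ≤ (R + Dᵀ * D).det := by
  have hdet : IsUnit R.det := (isUnit_iff_isUnit_det _).1 hR.isUnit
  have e : R + Dᵀ * D = R * (1 + (R⁻¹ * Dᵀ) * D) := by
    rw [mul_add, mul_one, Matrix.mul_assoc R⁻¹, mul_nonsing_inv_cancel_left _ _ hdet]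
  have hW : (D * (R⁻¹ * Dᵀ)).PosSemidef := by
    rw [← Matrix.mul_assoc]; exact posSemidef_conj' hR.inv.posSemidef D
  have h1 : (1 : ℝ) ≤ (1 + D * (R⁻¹ * Dᵀ)).det := by
    have hH : (1 + D * (R⁻¹ * Dᵀ)).IsHermitian := isHermitian_one.add hW.isHermitian
    rw [hH.det_eq_prod_eigenvalues]
    simp only [RCLike.ofReal_real_eq_id, id]
    refine Finset.one_le_prod fun i _ => ?_
    have hv := hH.eigenvalues_eq i
    have hn : hH.eigenvectorBasis i ⬝ᵥ hH.eigenvectorBasis i = 1 := by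
      have := (hH.eigenvectorBasis.orthonormal.1 i)
      rw [EuclideanSpace.norm_eq, Real.sqrt_eq_one] at this
      simpa [dotProduct, pow_two] using this
    rw [add_mulVec, one_mulVec, dotProduct_add] at hv
    have := hW.quad_nonneg (hH.eigenvectorBasis i)
    simp only [star_trivial, RCLike.re_to_real] at hv
    linarith
  rw [e, det_mul, det_one_add_mul_comm]
  exact le_mul_of_one_le_right hR.det_pos.le h1

end Inverse

end Matrix

/-! ### The spectral norm, the least eigenvalue and uniform bounds -/

namespace Matrix

section Norm

variable {ι κ : Type*} [Fintype ι] [Fintype κ] [DecidableEq ι] [DecidableEq κ]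

lemma dotProduct_self_eq_norm_sq (x : ι → ℝ) : x ⬝ᵥ x = ‖WithLp.toLp 2 x‖ ^ 2 := by
  rw [EuclideanSpace.real_norm_sq_eq]
  simp [dotProduct, pow_two]

lemma mulVec_sq_le (M : Matrix ι κ ℝ) (x : κ → ℝ) :
    (M *ᵥ x) ⬝ᵥ (M *ᵥ x) ≤ ‖M‖ ^ 2 * (x ⬝ᵥ x) := by
  rw [dotProduct_self_eq_norm_sq, dotProduct_self_eq_norm_sq, ← mul_pow]
  exact pow_le_pow_left₀ (norm_nonneg _) (M.l2_opNorm_mulVec (WithLp.toLp 2 x)) 2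

lemma abs_quad_le (M : Matrix ι ι ℝ) (x : ι → ℝ) : |x ⬝ᵥ (M *ᵥ x)| ≤ ‖M‖ * (x ⬝ᵥ x) := by
  have h := abs_real_inner_le_norm (WithLp.toLp 2 (M *ᵥ x)) (WithLp.toLp 2 x)
  rw [EuclideanSpace.inner_toLp_toLp] at h
  simp only [star_trivial] at h
  refine h.trans ?_
  rw [dotProduct_self_eq_norm_sq, pow_two, ← mul_assoc]
  exact mul_le_mul_of_nonneg_right (M.l2_opNorm_mulVec (WithLp.toLp 2 x)) (norm_nonneg _)

lemma quad_le_norm (M : Matrix ι ι ℝ) (x : ι → ℝ) : x ⬝ᵥ (M *ᵥ x) ≤ ‖M‖ * (x ⬝ᵥ x) :=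
  (le_abs_self _).trans (abs_quad_le M x)

lemma norm_sq_le_of_mulVec {M : Matrix ι κ ℝ} {c : ℝ} (hc : 0 ≤ c)
    (h : ∀ x : κ → ℝ, (M *ᵥ x) ⬝ᵥ (M *ᵥ x) ≤ c * (x ⬝ᵥ x)) : ‖M‖ ^ 2 ≤ c := by
  have : ‖M‖ ≤ √c := by
    rw [l2_opNorm_def]
    refine ContinuousLinearMap.opNorm_le_bound _ (Real.sqrt_nonneg _) fun x => ?_
    refine le_of_sq_le_sq ?_ (by positivity)
    rw [mul_pow, Real.sq_sqrt hc]
    have hx := h x.ofLp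
    rw [dotProduct_self_eq_norm_sq, dotProduct_self_eq_norm_sq] at hx
    exact hx
  exact (pow_le_pow_left₀ (norm_nonneg _) this 2).trans_eq (Real.sq_sqrt hc)

lemma PosSemidef.norm_le {M : Matrix ι ι ℝ} (hM : M.PosSemidef) {c : ℝ} (hc : 0 ≤ c)
    (h : ∀ x : ι → ℝ, x ⬝ᵥ (M *ᵥ x) ≤ c * (x ⬝ᵥ x)) : ‖M‖ ≤ c := by
  obtain ⟨N, rfl⟩ := CStarAlgebra.nonneg_iff_eq_star_mul_self.1 hM.nonneg
  rw [CStarRing.norm_star_mul_self, ← pow_two]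
  refine norm_sq_le_of_mulVec hc fun x => ?_
  rw [← quad_sq, ← conjTranspose_eq_transpose_of_trivial]
  exact h x

lemma norm_transpose_real (M : Matrix ι κ ℝ) : ‖Mᵀ‖ = ‖M‖ := by
  rw [← conjTranspose_eq_transpose_of_trivial, l2_opNorm_conjTranspose]

lemma abs_entry_le_norm (M : Matrix ι κ ℝ) (i : ι) (j : κ) : |M i j| ≤ ‖M‖ := by
  have h := mulVec_sq_le M (Pi.single j 1)
  have h1 : (Pi.single j 1 : κ → ℝ) ⬝ᵥ Pi.single j 1 = 1 := by simp
  rw [h1, mul_one, mulVec_single_one] at h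
  refine abs_le_of_sq_le_sq (le_trans ?_ h) (norm_nonneg _)
  rw [dotProduct, pow_two]
  exact Finset.single_le_sum (f := fun i => M.col j i * M.col j i)
    (fun i _ => mul_self_nonneg _) (Finset.mem_univ i)

end Norm

section UniformBounds

variable {ι κ μ : Type*} [Fintype ι] [Fintype κ] [Fintype μ] [DecidableEq ι] [DecidableEq κ]
  [DecidableEq μ]

/-- A sequence of matrices that is bounded in the induced Euclidean norm. -/
def UniformlyBounded (f : ℕ → Matrix ι κ ℝ) : Prop := ∃ c, ∀ t, ‖f t‖ ≤ c

namespace UniformlyBounded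

lemma exists_pos {f : ℕ → Matrix ι κ ℝ} (hf : UniformlyBounded f) :
    ∃ c, 0 < c ∧ ∀ t, ‖f t‖ ≤ c := by
  obtain ⟨c, hc⟩ := hf
  exact ⟨max c 1, by positivity, fun t => (hc t).trans (le_max_left _ _)⟩

lemma const (M : Matrix ι κ ℝ) : UniformlyBounded fun _ => M := ⟨‖M‖, fun _ => le_rfl⟩

lemma comp {f : ℕ → Matrix ι κ ℝ} (hf : UniformlyBounded f) (e : ℕ → ℕ) :
    UniformlyBounded fun t => f (e t) := by
  obtain ⟨c, hc⟩ := hf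
  exact ⟨c, fun t => hc _⟩

lemma mul {f : ℕ → Matrix ι κ ℝ} {g : ℕ → Matrix κ μ ℝ} (hf : UniformlyBounded f)
    (hg : UniformlyBounded g) : UniformlyBounded fun t => f t * g t := by
  obtain ⟨a, ha0, ha⟩ := hf.exists_pos
  obtain ⟨b, hb⟩ := hg
  exact ⟨a * b, fun t => (l2_opNorm_mul _ _).trans
    (mul_le_mul (ha t) (hb t) (norm_nonneg _) ha0.le)⟩

lemma add {f g : ℕ → Matrix ι κ ℝ} (hf : UniformlyBounded f)
    (hg : UniformlyBounded g) : UniformlyBounded fun t => f t + g t := by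
  obtain ⟨a, ha⟩ := hf
  obtain ⟨b, hb⟩ := hg
  exact ⟨a + b, fun t => (norm_add_le _ _).trans (add_le_add (ha t) (hb t))⟩

lemma transpose {f : ℕ → Matrix ι κ ℝ} (hf : UniformlyBounded f) :
    UniformlyBounded fun t => (f t)ᵀ := by
  obtain ⟨a, ha⟩ := hf
  exact ⟨a, fun t => (norm_transpose_real _).trans_le (ha t)⟩

lemma abs_entry {f : ℕ → Matrix ι κ ℝ} (hf : UniformlyBounded f) (i : ι) (j : κ) :
    ∃ c, ∀ t, |f t i j| ≤ c := by
  obtain ⟨a, ha⟩ := hf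
  exact ⟨a, fun t => (abs_entry_le_norm _ _ _).trans (ha t)⟩

lemma of_abs_entry {f : ℕ → Matrix ι κ ℝ} (h : ∀ i j, ∃ c, ∀ t, |f t i j| ≤ c) :
    UniformlyBounded f := by
  choose c hc using h
  refine ⟨∑ i, ∑ j, c i j * ‖(single i j 1 : Matrix ι κ ℝ)‖, fun t => ?_⟩
  have e : f t = ∑ i, ∑ j, f t i j • (single i j 1 : Matrix ι κ ℝ) := by
    conv_lhs => rw [matrix_eq_sum_single (f t)]
    simp [smul_single]
  rw [e]
  refine (norm_sum_le _ _).trans (Finset.sum_le_sum fun i _ => (norm_sum_le _ _).trans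
    (Finset.sum_le_sum fun j _ => ?_))
  rw [norm_smul]
  exact mul_le_mul_of_nonneg_right (hc i j t) (norm_nonneg _)

/-- A continuous function is bounded along a bounded sequence of matrices. -/
lemma bounded_of_continuous {F : Type*} [SeminormedAddCommGroup F] {f : ℕ → Matrix ι κ ℝ}
    (hf : UniformlyBounded f) {φ : Matrix ι κ ℝ → F} (hφ : Continuous φ) :
    ∃ c, ∀ t, ‖φ (f t)‖ ≤ c := by
  obtain ⟨a, ha⟩ := hf
  have : ProperSpace (Matrix ι κ ℝ) := FiniteDimensional.proper ℝ _
  obtain ⟨c, hc⟩ := (isCompact_closedBall (0 : Matrix ι κ ℝ) a).exists_bound_of_continuousOn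
    hφ.continuousOn
  exact ⟨c, fun t => hc _ (by simpa using ha t)⟩

lemma of_quad_le {f : ℕ → Matrix ι ι ℝ} (hf : ∀ t, (f t).PosSemidef) {g : ℕ → Matrix ι ι ℝ}
    (hg : UniformlyBounded g)
    (h : ∀ t x, x ⬝ᵥ (f t *ᵥ x) ≤ x ⬝ᵥ (g t *ᵥ x)) : UniformlyBounded f := by
  obtain ⟨c, hc0, hc⟩ := hg.exists_pos
  exact ⟨c, fun t => (hf t).norm_le hc0.le fun x => (h t x).trans ((quad_le_norm _ _).trans
    (mul_le_mul_of_nonneg_right (hc t) (dotProduct_self_nonneg' x)))⟩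

/-- If the inverses and the determinants of a sequence of invertible matrices are bounded, then so
are the matrices, because `M = det M • adj M⁻¹`. -/
lemma of_inv_of_det {f : ℕ → Matrix ι ι ℝ} (hf : ∀ t, IsUnit (f t))
    (hinv : UniformlyBounded fun t => (f t)⁻¹) {c : ℝ} (hdet : ∀ t, |(f t).det| ≤ c) :
    UniformlyBounded f := by
  obtain ⟨b, hb⟩ := hinv.bounded_of_continuous
    (φ := adjugate) (continuous_id.matrix_adjugate)
  refine ⟨c * b, fun t => ?_⟩
  have hd : IsUnit (f t).det := (isUnit_iff_isUnit_det _).1 (hf t)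
  have e : f t = (f t).det • adjugate (f t)⁻¹ := by
    conv_lhs => rw [← nonsing_inv_nonsing_inv _ hd, inv_def, det_nonsing_inv, Ring.inverse_eq_inv',
      inv_inv]
  rw [e, norm_smul, Real.norm_eq_abs]
  exact mul_le_mul (hdet t) (hb t) (norm_nonneg _) ((abs_nonneg _).trans (hdet t))

end UniformlyBounded

end UniformBounds

end Matrix

section LambdaMin

variable {ι : Type} [Fintype ι] [DecidableEq ι]

lemma lambdaMin_mul_le (M : Matrix ι ι ℝ) (x : ι → ℝ) :
    lambdaMin M * (x ⬝ᵥ x) ≤ x ⬝ᵥ (M *ᵥ x) := by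
  rcases eq_or_ne x 0 with rfl | hx
  · simp
  have hpos : 0 < x ⬝ᵥ x := by simpa using dotProduct_star_self_pos_iff.2 hx
  set s := √(x ⬝ᵥ x) with hs
  have hs0 : 0 < s := Real.sqrt_pos.2 hpos
  have hs2 : s * s = x ⬝ᵥ x := Real.mul_self_sqrt hpos.le
  have hunit : (s⁻¹ • x) ⬝ᵥ (s⁻¹ • x) = 1 := by
    rw [smul_dotProduct, dotProduct_smul, ← hs2, smul_eq_mul, smul_eq_mul]
    field_simp
  have hb : BddBelow (range fun x : {x : ι → ℝ // x ⬝ᵥ x = 1} => x.1 ⬝ᵥ (M *ᵥ x.1)) := by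
    refine ⟨-‖M‖, ?_⟩
    rintro _ ⟨y, rfl⟩
    have := abs_quad_le M y.1
    rw [y.2, mul_one] at this
    exact (abs_le.1 this).1
  have h : lambdaMin M ≤ _ := ciInf_le hb ⟨s⁻¹ • x, hunit⟩
  rw [mulVec_smul, smul_dotProduct, dotProduct_smul, smul_eq_mul, smul_eq_mul] at h
  rw [← hs2]
  calc lambdaMin M * (s * s) ≤ (s⁻¹ * (s⁻¹ * (x ⬝ᵥ (M *ᵥ x)))) * (s * s) :=
        mul_le_mul_of_nonneg_right h (by positivity)
    _ = x ⬝ᵥ (M *ᵥ x) := by field_simp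

lemma le_lambdaMin [Nonempty ι] {M : Matrix ι ι ℝ} {c : ℝ}
    (h : ∀ x : ι → ℝ, c * (x ⬝ᵥ x) ≤ x ⬝ᵥ (M *ᵥ x)) : c ≤ lambdaMin M := by
  obtain ⟨i⟩ := ‹Nonempty ι›
  have : Nonempty {x : ι → ℝ // x ⬝ᵥ x = 1} := ⟨⟨Pi.single i 1, by simp⟩⟩
  refine le_ciInf fun x => ?_
  simpa [x.2] using h x.1

/-- A positive infimum of least eigenvalues is a common lower bound: an infimum over an unbounded
set of reals is `0` by convention, hence not positive. -/
lemma iInf_lambdaMin_mul_le {f : ℕ → Matrix ι ι ℝ} (h : 0 < ⨅ t, lambdaMin (f t)) (t : ℕ)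
    (x : ι → ℝ) : (⨅ t, lambdaMin (f t)) * (x ⬝ᵥ x) ≤ x ⬝ᵥ (f t *ᵥ x) := by
  have hb : BddBelow (range fun t => lambdaMin (f t)) := by
    by_contra hb
    rw [Real.iInf_of_not_bddBelow hb] at h
    exact lt_irrefl _ h
  exact (mul_le_mul_of_nonneg_right (ciInf_le hb t) (dotProduct_self_nonneg' x)).trans
    (lambdaMin_mul_le _ _)

end LambdaMin

/-! ### One step of the Riccati recursion -/

namespace Matrix

variable {ι κ : Type*} [Fintype ι] [Fintype κ] [DecidableEq ι] [DecidableEq κ]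

/-- The Riccati operator of the stage with dynamics `x ↦ A x + B w` and cost `x' Q x + w' R w`. -/
noncomputable def riccati (A : Matrix ι ι ℝ) (B : Matrix ι κ ℝ) (Q : Matrix ι ι ℝ)
    (R : Matrix κ κ ℝ) (P : Matrix ι ι ℝ) : Matrix ι ι ℝ :=
  Q + Aᵀ * (P - P * B * (R + Bᵀ * P * B)⁻¹ * Bᵀ * P) * A

/-- The gain of the minimizing feedback `w = -K x` of the stage with cost-to-go `P`. -/
noncomputable def riccatiGain (A : Matrix ι ι ℝ) (B : Matrix ι κ ℝ)
    (R : Matrix κ κ ℝ) (P : Matrix ι ι ℝ) : Matrix κ ι ℝ :=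
  (R + Bᵀ * P * B)⁻¹ * Bᵀ * P * A

variable {A : Matrix ι ι ℝ} {B : Matrix ι κ ℝ} {Q : Matrix ι ι ℝ} {R : Matrix κ κ ℝ}
  {P P' : Matrix ι ι ℝ}

lemma posDef_add_conj (hR : R.PosDef) (hP : P.PosSemidef) : (R + Bᵀ * P * B).PosDef :=
  hR.add_posSemidef (posSemidef_conj hP B)

lemma isHermitian_riccati (hQ : Q.IsHermitian) (hR : R.IsHermitian) (hP : P.IsHermitian) :
    (riccati A B Q R P).IsHermitian := by
  refine isHermitian_of_transpose_eq ?_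
  simp only [riccati, transpose_add, transpose_sub, transpose_mul, transpose_transpose,
    transpose_nonsing_inv, transpose_eq_of_isHermitian hQ, transpose_eq_of_isHermitian hR,
    transpose_eq_of_isHermitian hP, Matrix.mul_assoc]

/-- Completion of the square: the stage cost plus the cost-to-go `P` is the quadratic form of the
Riccati operator plus a square that vanishes exactly at the minimizing feedback. -/
lemma riccati_complete_square (hR : R.PosDef) (hP : P.PosSemidef) (x : ι → ℝ) (w : κ → ℝ) :
    x ⬝ᵥ (Q *ᵥ x) + w ⬝ᵥ (R *ᵥ w) + (A *ᵥ x + B *ᵥ w) ⬝ᵥ (P *ᵥ (A *ᵥ x + B *ᵥ w)) =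
      x ⬝ᵥ (riccati A B Q R P *ᵥ x) +
        (w + riccatiGain A B R P *ᵥ x) ⬝ᵥ
          ((R + Bᵀ * P * B) *ᵥ (w + riccatiGain A B R P *ᵥ x)) := by
  have hS := posDef_add_conj (B := B) hR hP
  have hdet := (isUnit_iff_isUnit_det _).1 hS.isUnit
  set S := R + Bᵀ * P * B with hSdef
  set y := A *ᵥ x with hy
  set v := Bᵀ *ᵥ (P *ᵥ y) with hv
  have hK : riccatiGain A B R P *ᵥ x = S⁻¹ *ᵥ v := by
    rw [riccatiGain, ← hSdef, hv, hy]
    simp only [mulVec_mulVec, Matrix.mul_assoc]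
  have hSv : S *ᵥ (S⁻¹ *ᵥ v) = v := by rw [mulVec_mulVec, mul_nonsing_inv _ hdet, one_mulVec]
  have hric : x ⬝ᵥ (riccati A B Q R P *ᵥ x) =
      x ⬝ᵥ (Q *ᵥ x) + (y ⬝ᵥ (P *ᵥ y) - v ⬝ᵥ (S⁻¹ *ᵥ v)) := by
    have e : P * B * S⁻¹ * Bᵀ * P = (Bᵀ * P)ᵀ * S⁻¹ * (Bᵀ * P) := by
      rw [transpose_mul, transpose_transpose, transpose_eq_of_isHermitian hP.isHermitian]
      simp only [Matrix.mul_assoc]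
    rw [riccati, ← hSdef, add_mulVec, dotProduct_add, quad_conj, ← hy, sub_mulVec, dotProduct_sub,
      e, quad_conj, ← mulVec_mulVec]
  have hSw : w ⬝ᵥ (S *ᵥ w) = w ⬝ᵥ (R *ᵥ w) + (B *ᵥ w) ⬝ᵥ (P *ᵥ (B *ᵥ w)) := by
    rw [hSdef, add_mulVec, dotProduct_add, quad_conj]
  have hwv : (B *ᵥ w) ⬝ᵥ (P *ᵥ y) = w ⬝ᵥ v := by
    rw [hv, dotProduct_transpose_mulVec, dotProduct_comm]
  have hsym : y ⬝ᵥ (P *ᵥ (B *ᵥ w)) = w ⬝ᵥ v := by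
    rw [dotProduct_mulVec_comm hP.isHermitian, hwv]
  have hsym2 : (S⁻¹ *ᵥ v) ⬝ᵥ (S *ᵥ w) = w ⬝ᵥ v := by
    rw [dotProduct_mulVec_comm hS.isHermitian, hSv]
  rw [hK, hric, mulVec_add S, hSv, mulVec_add P]
  simp only [add_dotProduct, dotProduct_add]
  rw [hSw, hwv, hsym, hsym2, dotProduct_comm (S⁻¹ *ᵥ v) v]
  ring

lemma riccati_quad_le (hR : R.PosDef) (hP : P.PosSemidef) (x : ι → ℝ) (w : κ → ℝ) :
    x ⬝ᵥ (riccati A B Q R P *ᵥ x) ≤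
      x ⬝ᵥ (Q *ᵥ x) + w ⬝ᵥ (R *ᵥ w) + (A *ᵥ x + B *ᵥ w) ⬝ᵥ (P *ᵥ (A *ᵥ x + B *ᵥ w)) := by
  rw [riccati_complete_square hR hP]
  exact le_add_of_nonneg_right ((posDef_add_conj hR hP).posSemidef.quad_nonneg _)

lemma riccati_quad_eq (hR : R.PosDef) (hP : P.PosSemidef) (x : ι → ℝ) :
    x ⬝ᵥ (riccati A B Q R P *ᵥ x) =
      x ⬝ᵥ (Q *ᵥ x) + (-(riccatiGain A B R P *ᵥ x)) ⬝ᵥ (R *ᵥ (-(riccatiGain A B R P *ᵥ x))) +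
        (A *ᵥ x + B *ᵥ (-(riccatiGain A B R P *ᵥ x))) ⬝ᵥ
          (P *ᵥ (A *ᵥ x + B *ᵥ (-(riccatiGain A B R P *ᵥ x)))) := by
  rw [riccati_complete_square hR hP]
  simp

lemma le_riccati (hQ : Q.IsHermitian) (hR : R.PosDef) (hP : P.PosSemidef) :
    Q ≤ riccati A B Q R P := by
  refine le_of_quad hQ (isHermitian_riccati hQ hR.isHermitian hP.isHermitian) fun x => ?_
  rw [riccati_quad_eq hR hP]
  have h1 := hR.posSemidef.quad_nonneg (-(riccatiGain A B R P *ᵥ x))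
  have h2 := hP.quad_nonneg (A *ᵥ x + B *ᵥ (-(riccatiGain A B R P *ᵥ x)))
  linarith

lemma riccati_mono (hQ : Q.IsHermitian) (hR : R.PosDef) (hP : P.PosSemidef) (h : P ≤ P') :
    riccati A B Q R P ≤ riccati A B Q R P' := by
  have hP' : P'.PosSemidef := by
    have := hP.add (le_iff.1 h)
    rwa [add_sub_cancel] at this
  refine le_of_quad (isHermitian_riccati hQ hR.isHermitian hP.isHermitian)
    (isHermitian_riccati hQ hR.isHermitian hP'.isHermitian) fun x => ?_
  rw [riccati_quad_eq hR hP']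
  refine (riccati_quad_le hR hP x (-(riccatiGain A B R P' *ᵥ x))).trans ?_
  gcongr
  exact quad_mono h _

/-! ### Dead-beat control -/

/-- The gain of the minimum-norm feedback `w = -L x` that steers `x` to zero in one step. -/
noncomputable def deadbeatGain (A : Matrix ι ι ℝ) (B : Matrix ι κ ℝ) : Matrix κ ι ℝ :=
  Bᵀ * (B * Bᵀ)⁻¹ * A

lemma deadbeat_step (hB : (B * Bᵀ).PosDef) (x : ι → ℝ) :
    A *ᵥ x + B *ᵥ (-(deadbeatGain A B *ᵥ x)) = 0 := by
  have hdet := (isUnit_iff_isUnit_det _).1 hB.isUnit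
  have e : B * deadbeatGain A B = A := by
    rw [deadbeatGain, Matrix.mul_assoc, ← Matrix.mul_assoc, mul_nonsing_inv_cancel_left _ _ hdet]
  rw [mulVec_neg, mulVec_mulVec, e, add_neg_cancel]

/-- The cost `x' (Q + L' R L) x` of steering to zero in one step bounds the Riccati operator,
whatever the cost-to-go. -/
lemma riccati_le_deadbeat (hQ : Q.IsHermitian) (hR : R.PosDef) (hP : P.PosSemidef)
    (hB : (B * Bᵀ).PosDef) :
    riccati A B Q R P ≤ Q + (deadbeatGain A B)ᵀ * R * deadbeatGain A B := by
  refine le_of_quad (isHermitian_riccati hQ hR.isHermitian hP.isHermitian)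
    (hQ.add (posSemidef_conj hR.posSemidef _).isHermitian) fun x => ?_
  refine (riccati_quad_le hR hP x (-(deadbeatGain A B *ᵥ x))).trans_eq ?_
  rw [deadbeat_step hB, zero_dotProduct, add_zero, mulVec_neg, neg_dotProduct, dotProduct_neg,
    neg_neg, add_mulVec, dotProduct_add, quad_conj]

/-- Steering to zero in one step is strictly suboptimal: its input would have to be the optimal
one, and then both inputs would vanish. -/
lemma riccati_quad_lt_deadbeat (hR : R.PosDef) (hP : P.PosSemidef)
    (hB : (B * Bᵀ).PosDef) (hA : IsUnit A) {x : ι → ℝ} (hx : x ≠ 0) :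
    x ⬝ᵥ (riccati A B Q R P *ᵥ x) <
      x ⬝ᵥ ((Q + (deadbeatGain A B)ᵀ * R * deadbeatGain A B) *ᵥ x) := by
  have hAdet := (isUnit_iff_isUnit_det _).1 hA
  set w := -(deadbeatGain A B *ᵥ x) with hw
  have hz : A *ᵥ x + B *ᵥ w = 0 := deadbeat_step hB x
  have hw0 : w ≠ 0 := by
    intro h
    rw [h, mulVec_zero, add_zero] at hz
    exact hx (by simpa [mulVec_mulVec, nonsing_inv_mul _ hAdet] using congrArg (A⁻¹ *ᵥ ·) hz)
  have hcost : x ⬝ᵥ ((Q + (deadbeatGain A B)ᵀ * R * deadbeatGain A B) *ᵥ x) =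
      x ⬝ᵥ (Q *ᵥ x) + w ⬝ᵥ (R *ᵥ w) := by
    rw [hw, mulVec_neg, neg_dotProduct, dotProduct_neg,
      neg_neg, add_mulVec, dotProduct_add, quad_conj]
  have hne : w + riccatiGain A B R P *ᵥ x ≠ 0 := by
    intro h
    clear_value w
    have hS := posDef_add_conj (B := B) hR hP
    have hSdet := (isUnit_iff_isUnit_det _).1 hS.isUnit
    -- `S w = -B' P A x`, and `A x = -B w` turns this into `R w = 0`
    have h1 : (R + Bᵀ * P * B) *ᵥ w + (Bᵀ * P) *ᵥ (A *ᵥ x) = 0 := by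
      have := congrArg ((R + Bᵀ * P * B) *ᵥ ·) h
      simp only [mulVec_zero, mulVec_add, riccatiGain, Matrix.mul_assoc, mulVec_mulVec] at this
      rw [← Matrix.mul_assoc Bᵀ P B, mul_nonsing_inv_cancel_left _ _ hSdet] at this
      simpa only [mulVec_mulVec, Matrix.mul_assoc] using this
    have h2 : A *ᵥ x = -(B *ᵥ w) := eq_neg_of_add_eq_zero_left hz
    rw [h2, add_mulVec, mulVec_neg, mulVec_mulVec, add_neg_cancel_right] at h1
    have := hR.quad_pos hw0
    rw [h1, dotProduct_zero] at this
    exact lt_irrefl _ this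
  have hsq := riccati_complete_square (A := A) (B := B) (Q := Q) hR hP x w
  rw [hz, zero_dotProduct, add_zero] at hsq
  rw [hcost, hsq]
  exact lt_add_of_pos_right _ ((posDef_add_conj hR hP).quad_pos hne)

/-! ### Contraction of the Riccati operator in the Thompson metric -/

/-- The Woodbury identity in the form in which it occurs in the Riccati operator. -/
lemma inv_add_conj_inv (hP : P.PosDef) (hR : R.PosDef) :
    (P⁻¹ + B * R⁻¹ * Bᵀ)⁻¹ = P - P * B * (R + Bᵀ * P * B)⁻¹ * Bᵀ * P := by
  have hPd := (isUnit_iff_isUnit_det _).1 hP.isUnit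
  have hRd := (isUnit_iff_isUnit_det _).1 hR.isUnit
  have h := add_mul_mul_inv_eq_sub (A := P⁻¹) (U := B) (C := R⁻¹) (V := Bᵀ) hP.inv.isUnit
    hR.inv.isUnit (by
      rw [nonsing_inv_nonsing_inv _ hPd, nonsing_inv_nonsing_inv _ hRd]
      exact (posDef_add_conj hR hP.posSemidef).isUnit)
  rwa [nonsing_inv_nonsing_inv _ hPd, nonsing_inv_nonsing_inv _ hRd] at h

lemma riccati_eq_add_inv (hA : IsUnit A) (hP : P.PosDef) (hR : R.PosDef) :
    riccati A B Q R P = Q + (A⁻¹ * (P⁻¹ + B * R⁻¹ * Bᵀ) * (Aᵀ)⁻¹)⁻¹ := by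
  have hAd := (isUnit_iff_isUnit_det _).1 hA
  have hAd' : IsUnit (Aᵀ).det := by rwa [det_transpose]
  rw [riccati, mul_inv_rev, mul_inv_rev, nonsing_inv_nonsing_inv _ hAd,
    nonsing_inv_nonsing_inv _ hAd', inv_add_conj_inv hP hR, Matrix.mul_assoc]

lemma add_inv_inv {N : Matrix ι ι ℝ} (hQ : Q.PosDef) (hN : N.PosDef) :
    (Q + N⁻¹)⁻¹ = Q⁻¹ - Q⁻¹ * (N + Q⁻¹)⁻¹ * Q⁻¹ := by
  have h := inv_add_conj_inv (B := (1 : Matrix ι ι ℝ)) hQ.inv hN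
  simpa [nonsing_inv_nonsing_inv _ ((isUnit_iff_isUnit_det _).1 hQ.isUnit)] using h

/-- Riccati operators contract the Thompson metric. With `N_P = A⁻¹ (P⁻¹ + B R⁻¹ B') A'⁻¹` the
inverse of the Riccati operator is `g(N_P) = Q⁻¹ - Q⁻¹ (N_P + Q⁻¹)⁻¹ Q⁻¹`, a concave function, and
`g` takes values between `g(A⁻¹ B R⁻¹ B' A'⁻¹)`, which is the matrix in the hypothesis on `ε`, and
`Q⁻¹`; the difference of these bounds is the matrix in the hypothesis on `ζ`. -/
lemma riccati_le_exp_smul (hA : IsUnit A) (hQ : Q.PosDef) (hR : R.PosDef) (hP : P.PosDef)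
    (hP' : P'.PosDef) {z e δ : ℝ} (hz : 0 < z) (he : 0 < e) (hδ : 0 ≤ δ)
    (hzeta : ‖(Q + Q * A⁻¹ * B * R⁻¹ * Bᵀ * (Aᵀ)⁻¹ * Q)⁻¹‖ ≤ z)
    (heps : ∀ x : ι → ℝ, e * (x ⬝ᵥ x) ≤ x ⬝ᵥ ((A⁻¹ * B * (R + Bᵀ * (Aᵀ)⁻¹ * Q * A⁻¹ * B)⁻¹
      * Bᵀ * (Aᵀ)⁻¹) *ᵥ x))
    (h : P' ≤ Real.exp δ • P) :
    riccati A B Q R P' ≤ Real.exp (z / (z + e) * δ) • riccati A B Q R P := by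
  have hAd := (isUnit_iff_isUnit_det _).1 hA
  have hQd := (isUnit_iff_isUnit_det _).1 hQ.isUnit
  have hAT : (A⁻¹)ᵀ = (Aᵀ)⁻¹ := transpose_nonsing_inv A
  set G := A⁻¹ * B with hG
  have hGT : Gᵀ = Bᵀ * (Aᵀ)⁻¹ := by rw [hG, transpose_mul, hAT]
  set V := G * R⁻¹ * Gᵀ with hV
  have hVpsd : V.PosSemidef := posSemidef_conj' hR.inv.posSemidef G
  have hVeq : A⁻¹ * (B * R⁻¹ * Bᵀ) * (Aᵀ)⁻¹ = V := by
    rw [hV, hGT, hG]; simp only [Matrix.mul_assoc]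
  -- the lower bound of the inverse of the Riccati operator
  set E := G * (R + Gᵀ * Q * G)⁻¹ * Gᵀ with hE
  have hEeq : A⁻¹ * B * (R + Bᵀ * (Aᵀ)⁻¹ * Q * A⁻¹ * B)⁻¹ * Bᵀ * (Aᵀ)⁻¹ = E := by
    rw [hE, hGT, hG]; simp only [Matrix.mul_assoc]
  have hEW : E = Q⁻¹ - Q⁻¹ * (V + Q⁻¹)⁻¹ * Q⁻¹ := by
    have e1 : (V + Q⁻¹)⁻¹ = Q - Q * E * Q := by
      rw [add_comm, hV, inv_add_conj_inv hQ hR, hE]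
      simp only [Matrix.mul_assoc]
    rw [e1, mul_sub, sub_mul, nonsing_inv_mul _ hQd, one_mul, Matrix.mul_assoc Q E Q,
      nonsing_inv_mul_cancel_left _ _ hQd, Matrix.mul_assoc, mul_nonsing_inv _ hQd, mul_one,
      sub_sub_cancel]
  have hZ : (Q + Q * A⁻¹ * B * R⁻¹ * Bᵀ * (Aᵀ)⁻¹ * Q)⁻¹ = Q⁻¹ * (V + Q⁻¹)⁻¹ * Q⁻¹ := by
    have e1 : Q + Q * A⁻¹ * B * R⁻¹ * Bᵀ * (Aᵀ)⁻¹ * Q = Q * ((V + Q⁻¹) * Q) := by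
      rw [add_mul, mul_add, nonsing_inv_mul _ hQd, mul_one, add_comm, hV, hGT, hG]
      simp only [Matrix.mul_assoc]
    rw [e1, mul_inv_rev, mul_inv_rev]
  rw [hZ] at hzeta
  rw [hEeq] at heps
  -- the two values of the Riccati operator
  have hconj : ∀ {X : Matrix ι ι ℝ}, X.PosSemidef → (A⁻¹ * X * (Aᵀ)⁻¹).PosSemidef := by
    intro X hX
    rw [← hAT]; exact posSemidef_conj' hX _
  have hN : ∀ {X : Matrix ι ι ℝ}, X.PosDef →
      (A⁻¹ * (X⁻¹ + B * R⁻¹ * Bᵀ) * (Aᵀ)⁻¹).PosDef := by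
    intro X hX
    rw [← hAT, ← conjTranspose_eq_transpose_of_trivial A⁻¹, ← star_eq_conjTranspose]
    exact (IsUnit.posDef_star_right_conjugate_iff ((isUnit_nonsing_inv_iff).2 hA)).2
      (hX.inv.add_posSemidef (posSemidef_conj' hR.inv.posSemidef B))
  have hexpand : ∀ X : Matrix ι ι ℝ,
      A⁻¹ * (X⁻¹ + B * R⁻¹ * Bᵀ) * (Aᵀ)⁻¹ = A⁻¹ * X⁻¹ * (Aᵀ)⁻¹ + V := by
    intro X
    rw [mul_add, add_mul, hVeq]
  set N := A⁻¹ * (P⁻¹ + B * R⁻¹ * Bᵀ) * (Aᵀ)⁻¹ with hNdef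
  set N' := A⁻¹ * (P'⁻¹ + B * R⁻¹ * Bᵀ) * (Aᵀ)⁻¹ with hNdef'
  have hf := riccati_eq_add_inv (B := B) (Q := Q) hA hP hR
  have hf' := riccati_eq_add_inv (B := B) (Q := Q) hA hP' hR
  rw [← hNdef] at hf
  rw [← hNdef'] at hf'
  have hfpd : (riccati A B Q R P).PosDef := by rw [hf]; exact hQ.add (hN hP).inv
  have hfpd' : (riccati A B Q R P').PosDef := by rw [hf']; exact hQ.add (hN hP').inv
  have hg : (riccati A B Q R P)⁻¹ = Q⁻¹ - Q⁻¹ * (N + Q⁻¹)⁻¹ * Q⁻¹ := by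
    rw [hf, add_inv_inv hQ (hN hP)]
  have hg' : (riccati A B Q R P')⁻¹ = Q⁻¹ - Q⁻¹ * (N' + Q⁻¹)⁻¹ * Q⁻¹ := by
    rw [hf', add_inv_inv hQ (hN hP')]
  -- concavity of `g` on the segment from `V` to `N`
  set s := Real.exp (-δ) with hs
  have hs0 : 0 < s := Real.exp_pos _
  have hs1 : s ≤ 1 := Real.exp_le_one_iff.2 (by linarith)
  have hPinv : s • P⁻¹ ≤ P'⁻¹ := by
    have := hP'.inv_anti h
    rwa [inv_smul_real _ hP.isUnit (Real.exp_pos δ).ne', ← Real.exp_neg] at this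
  have hNle : (1 - s) • (V + Q⁻¹) + s • (N + Q⁻¹) ≤ N' + Q⁻¹ := by
    rw [le_iff]
    have e1 : N' + Q⁻¹ - ((1 - s) • (V + Q⁻¹) + s • (N + Q⁻¹)) =
        A⁻¹ * (P'⁻¹ - s • P⁻¹) * (Aᵀ)⁻¹ := by
      rw [hNdef, hNdef', hexpand, hexpand, mul_sub, sub_mul, mul_smul_comm, smul_mul_assoc]
      module
    rw [e1]
    exact hconj (le_iff.1 hPinv)
  have hVQ : (V + Q⁻¹).PosDef := hQ.inv.posSemidef_add hVpsd
  have hconv := ((hN hP').add hQ.inv).inv_le_convex_comb hVQ ((hN hP).add hQ.inv)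
    (sub_nonneg.2 hs1) hs0.le (sub_add_cancel 1 s) hNle
  set r := z / (z + e) with hr
  have hQquad : ∀ (X : Matrix ι ι ℝ) (x : ι → ℝ),
      x ⬝ᵥ ((Q⁻¹ * X * Q⁻¹) *ᵥ x) = (Q⁻¹ *ᵥ x) ⬝ᵥ (X *ᵥ (Q⁻¹ *ᵥ x)) := by
    intro X x
    conv_lhs => rw [← transpose_eq_of_isHermitian hQ.inv.isHermitian]
    rw [transpose_eq_of_isHermitian hQ.inv.isHermitian, ← quad_conj,
      transpose_eq_of_isHermitian hQ.inv.isHermitian]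
  have hkey : Real.exp (-(r * δ)) • (riccati A B Q R P)⁻¹ ≤ (riccati A B Q R P')⁻¹ := by
    refine le_of_quad (isHermitian_smul hfpd.inv.isHermitian _) hfpd'.inv.isHermitian fun x => ?_
    have h1 := quad_mono hconv (Q⁻¹ *ᵥ x)
    rw [add_mulVec, dotProduct_add, quad_smul, quad_smul] at h1
    have h2 := heps x
    have h3 : x ⬝ᵥ ((Q⁻¹ * (V + Q⁻¹)⁻¹ * Q⁻¹) *ᵥ x) ≤ z * (x ⬝ᵥ x) :=
      (quad_le_norm _ x).trans
        (mul_le_mul_of_nonneg_right hzeta (dotProduct_self_nonneg' x))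
    have h4 := ((hN hP).add hQ.inv).inv.posSemidef.quad_nonneg (Q⁻¹ *ᵥ x)
    have h5 := hfpd.inv.posSemidef.quad_nonneg x
    have hexp : Real.exp (-(r * δ)) ≤ (1 - r) + r * s := by
      have hr0 : 0 ≤ r := by positivity
      have hr1 : r ≤ 1 := div_le_one_of_le₀ (by linarith) (by positivity)
      have := convexOn_exp.2 (mem_univ 0) (mem_univ (-δ)) (sub_nonneg.2 hr1) hr0
        (sub_add_cancel 1 r)
      simpa [hs] using this
    have hr' : 1 - r = e / (z + e) := by rw [hr]; field_simp; ring
    rw [hQquad] at h3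
    rw [hEW, sub_mulVec, dotProduct_sub, hQquad] at h2
    rw [quad_smul]
    rw [hg, sub_mulVec, dotProduct_sub, hQquad] at h5 ⊢
    rw [hg', sub_mulVec, dotProduct_sub, hQquad]
    set q := x ⬝ᵥ (Q⁻¹ *ᵥ x)
    set a := (Q⁻¹ *ᵥ x) ⬝ᵥ ((V + Q⁻¹)⁻¹ *ᵥ (Q⁻¹ *ᵥ x))
    set b := (Q⁻¹ *ᵥ x) ⬝ᵥ ((N + Q⁻¹)⁻¹ *ᵥ (Q⁻¹ *ᵥ x))
    -- `g(N)` is at most `Q⁻¹`, hence at most `E + z`, hence at most `(1 + z / e) E`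
    have h6 : (1 - r) * (q - b) ≤ q - a := by
      rw [hr', div_mul_eq_mul_div, div_le_iff₀ (by positivity)]
      have h7 : e * a ≤ z * (q - a) := by
        calc e * a ≤ e * (z * (x ⬝ᵥ x)) := mul_le_mul_of_nonneg_left h3 he.le
          _ = z * (e * (x ⬝ᵥ x)) := by ring
          _ ≤ z * (q - a) := mul_le_mul_of_nonneg_left h2 hz.le
      have h8 := mul_nonneg he.le h4
      linarith
    calc Real.exp (-(r * δ)) * (q - b) ≤ ((1 - r) + r * s) * (q - b) :=
          mul_le_mul_of_nonneg_right hexp h5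
      _ = (1 - s) * ((1 - r) * (q - b)) + s * (q - b) := by ring
      _ ≤ (1 - s) * (q - a) + s * (q - b) := by
          gcongr
      _ ≤ _ := by linarith
  have hfin := (hfpd.inv.smul (Real.exp_pos (-(r * δ)))).inv_anti hkey
  rwa [inv_smul_real _ hfpd.inv.isUnit (Real.exp_pos _).ne', ← Real.exp_neg, neg_neg,
    nonsing_inv_nonsing_inv _ ((isUnit_iff_isUnit_det _).1 hfpd.isUnit),
    nonsing_inv_nonsing_inv _ ((isUnit_iff_isUnit_det _).1 hfpd'.isUnit)] at hfin

end Matrix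

/-! ### The lifted problem data -/

namespace LQRData

variable {n m : ℕ} (S : LQRData n m)

lemma Theta_add (k i j : ℕ) : S.Theta k (i + j) = S.Theta (k + i) j * S.Theta k i := by
  induction j with
  | zero => simp [Theta]
  | succ j ih => rw [← add_assoc, Theta, ih, Theta, Matrix.mul_assoc, add_assoc]

variable {S}

lemma isUnit_Theta (hA : ∀ k, IsUnit (S.A k)) (k j : ℕ) : IsUnit (S.Theta k j) := by
  induction j with
  | zero => exact isUnit_one
  | succ j ih => exact (hA _).mul ih

lemma isUnit_det_Theta (hA : ∀ k, IsUnit (S.A k)) (k j : ℕ) : IsUnit (S.Theta k j).det :=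
  (isUnit_iff_isUnit_det _).1 (isUnit_Theta hA k j)

lemma inv_Ahat (hA : ∀ k, IsUnit (S.A k)) (d t : ℕ) :
    (S.Ahat d t)⁻¹ = Matrix.of fun p q : Fin (d + 1) × Fin n =>
      if q.1 ≤ p.1 then (S.Theta (d * t) p.1 * (S.Theta (d * t) q.1)⁻¹) p.2 q.2 else 0 := by
  refine inv_eq_right_inv ?_
  rw [Ahat, sub_mul, one_mul, sub_eq_iff_eq_add]
  ext ⟨i, a⟩ ⟨j, b⟩
  rw [Matrix.add_apply, Matrix.mul_apply, Fintype.sum_prod_type]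
  simp only [Matrix.of_apply]
  induction i using Fin.cases with
  | zero =>
    rw [Finset.sum_eq_zero (by intro q _; simp), add_zero]
    rcases eq_or_ne j 0 with rfl | hj
    · simp [Theta, Matrix.one_apply]
    · have : ¬ j ≤ 0 := by simpa using hj
      simp [this, hj.symm]
  | succ i =>
    rw [Finset.sum_eq_single i.castSucc
      (by
        intro q _ hq
        refine Finset.sum_eq_zero fun c _ => ?_
        have : ¬ ((i.succ : Fin (d + 1)) : ℕ) = q + 1 := by
          intro h
          apply hq
          ext
          simp at h ⊢
          omega
        rw [if_neg this, zero_mul]) (by simp)]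
    simp only [Fin.val_succ, Fin.val_castSucc, if_true]
    rcases lt_trichotomy (j : ℕ) (i + 1) with h | h | h
    · have h1 : j ≤ i.succ := by rw [Fin.le_def, Fin.val_succ]; omega
      have h2 : j ≤ i.castSucc := by rw [Fin.le_def, Fin.val_castSucc]; omega
      have h3 : (i.succ, a) ≠ (j, b) := by
        intro h'
        have := congrArg (fun x : Fin (d + 1) × Fin n => (x.1 : ℕ)) h'
        simp at this
        omega
      simp only [h1, h2, if_true]
      rw [Matrix.one_apply_ne h3, zero_add, Theta, Matrix.mul_assoc, Matrix.mul_apply]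
    · have h1 : j = i.succ := by ext; simpa using h
      have h2 : ¬ i.succ ≤ i.castSucc := by rw [Fin.le_def, Fin.val_castSucc, Fin.val_succ]; omega
      subst h1
      simp only [h2, if_false, le_refl, if_true, mul_zero, Finset.sum_const_zero, add_zero,
        Fin.val_succ]
      rw [mul_nonsing_inv _ (isUnit_det_Theta hA _ _)]
      simp [Matrix.one_apply]
    · have h1 : ¬ j ≤ i.succ := by rw [Fin.le_def, Fin.val_succ]; omega
      have h2 : ¬ j ≤ i.castSucc := by rw [Fin.le_def, Fin.val_castSucc]; omega
      have h3 : (i.succ, a) ≠ (j, b) := by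
        intro h'
        have := congrArg (fun x : Fin (d + 1) × Fin n => (x.1 : ℕ)) h'
        simp at this
        omega
      simp only [h1, h2, if_false, mul_zero, Finset.sum_const_zero, add_zero]
      rw [Matrix.one_apply_ne h3]

lemma mul_firstBlock_apply {ι : Type*} {d : ℕ} (M : Matrix ι (Fin (d + 1) × Fin n) ℝ) (p : ι)
    (b : Fin n) : (M * firstBlock n d) p b = M p (0, b) := by
  simp [Matrix.mul_apply, firstBlock]

lemma lastBlock_mul_apply {ι : Type*} {d : ℕ} (M : Matrix (Fin (d + 1) × Fin n) ι ℝ) (a : Fin n)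
    (q : ι) : (lastBlock n d * M) a q = M (Fin.last d, a) q := by
  simp [Matrix.mul_apply, lastBlock]

lemma Phi_eq (hA : ∀ k, IsUnit (S.A k)) (d t : ℕ) : S.Phi d t = S.Theta (d * t) d := by
  ext a b
  rw [Phi, mul_firstBlock_apply, lastBlock_mul_apply, inv_Ahat hA]
  simp [Theta]

/-! ### Boundedness of the lifted data -/

lemma norm_C (hQ : ∀ k, (S.Q k).PosSemidef) (k : ℕ) : ‖S.C k‖ ^ 2 = ‖S.Q k‖ := by
  have h1 : star (S.C k) = S.C k := (CFC.sqrt_nonneg (S.Q k)).isSelfAdjoint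
  have h2 : S.C k * S.C k = S.Q k := CFC.sqrt_mul_sqrt_self _ (hQ k).nonneg
  have h3 := CStarRing.norm_star_mul_self (x := S.C k)
  rw [h1, h2] at h3
  rw [h3, pow_two]

lemma uniformlyBounded_A (hbdd : S.IsBounded) : UniformlyBounded S.A := by
  obtain ⟨a, b, q, r, -, -, -, -, h⟩ := hbdd
  exact ⟨a, fun t => (h t).1⟩

lemma uniformlyBounded_B (hbdd : S.IsBounded) : UniformlyBounded S.B := by
  obtain ⟨a, b, q, r, -, -, -, -, h⟩ := hbdd
  exact ⟨b, fun t => (h t).2.1⟩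

lemma uniformlyBounded_R (hbdd : S.IsBounded) : UniformlyBounded S.R := by
  obtain ⟨a, b, q, r, -, -, -, -, h⟩ := hbdd
  exact ⟨r, fun t => (h t).2.2.2⟩

lemma uniformlyBounded_C (hQ : ∀ k, (S.Q k).PosSemidef) (hbdd : S.IsBounded) :
    UniformlyBounded S.C := by
  obtain ⟨a, b, q, r, -, -, -, -, h⟩ := hbdd
  exact ⟨√q, fun t => Real.le_sqrt_of_sq_le ((norm_C hQ t).trans_le (h t).2.2.1)⟩

lemma uniformlyBounded_Theta (hbdd : S.IsBounded) (e : ℕ → ℕ) (j : ℕ) :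
    UniformlyBounded fun t => S.Theta (e t) j := by
  induction j with
  | zero => exact .const 1
  | succ j ih => exact ((uniformlyBounded_A hbdd).comp fun t => e t + j).mul ih

lemma uniformlyBounded_inv_Ahat (hA : ∀ k, IsUnit (S.A k)) (hbdd : S.IsBounded) (d : ℕ) :
    UniformlyBounded fun t => (S.Ahat d t)⁻¹ := by
  refine .of_abs_entry fun p q => ?_
  simp only [inv_Ahat hA, Matrix.of_apply]
  by_cases h : q.1 ≤ p.1
  · obtain ⟨c, hc⟩ := (uniformlyBounded_Theta hbdd (fun t => d * t + q.1) (p.1 - q.1)).abs_entry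
      p.2 q.2
    refine ⟨c, fun t => ?_⟩
    have e : S.Theta (d * t) p.1 = S.Theta (d * t + q.1) (p.1 - q.1) * S.Theta (d * t) q.1 := by
      rw [← Theta_add, Nat.add_sub_cancel' h]
    rw [if_pos h, e, mul_nonsing_inv_cancel_right _ _ (isUnit_det_Theta hA _ _)]
    exact hc t
  · exact ⟨0, fun t => by simp [h]⟩

lemma uniformlyBounded_Bhat (hbdd : S.IsBounded) (d : ℕ) :
    UniformlyBounded fun t => S.Bhat d t := by
  refine .of_abs_entry fun p q => ?_
  obtain ⟨c, hc⟩ := ((uniformlyBounded_B hbdd).comp fun t => d * t + q.1).abs_entry p.2 q.2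
  refine ⟨max c 0, fun t => ?_⟩
  simp only [Bhat, Matrix.of_apply]
  split_ifs
  · exact (hc t).trans (le_max_left _ _)
  · simp

lemma uniformlyBounded_Chat (hQ : ∀ k, (S.Q k).PosSemidef) (hbdd : S.IsBounded) (d : ℕ) :
    UniformlyBounded fun t => S.Chat d t := by
  refine .of_abs_entry fun p q => ?_
  obtain ⟨c, hc⟩ := ((uniformlyBounded_C hQ hbdd).comp fun t => d * t + p.1).abs_entry p.2 q.2
  refine ⟨max c 0, fun t => ?_⟩
  simp only [Chat, Matrix.of_apply]
  split_ifs
  · exact (hc t).trans (le_max_left _ _)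
  · simp

lemma uniformlyBounded_Rdiag (hbdd : S.IsBounded) (d : ℕ) :
    UniformlyBounded fun t => S.Rdiag d t := by
  refine .of_abs_entry fun p q => ?_
  obtain ⟨c, hc⟩ := ((uniformlyBounded_R hbdd).comp fun t => d * t + p.1).abs_entry p.2 q.2
  refine ⟨max c 0, fun t => ?_⟩
  simp only [Rdiag, Matrix.of_apply]
  split_ifs
  · exact (hc t).trans (le_max_left _ _)
  · simp

lemma uniformlyBounded_Xi (hQ : ∀ k, (S.Q k).PosSemidef) (hA : ∀ k, IsUnit (S.A k))
    (hbdd : S.IsBounded) (d : ℕ) : UniformlyBounded fun t => S.Xi d t :=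
  ((uniformlyBounded_Chat hQ hbdd d).mul (uniformlyBounded_inv_Ahat hA hbdd d)).mul (.const _)

lemma uniformlyBounded_Del (hQ : ∀ k, (S.Q k).PosSemidef) (hA : ∀ k, IsUnit (S.A k))
    (hbdd : S.IsBounded) (d : ℕ) : UniformlyBounded fun t => S.Del d t :=
  ((uniformlyBounded_Chat hQ hbdd d).mul (uniformlyBounded_inv_Ahat hA hbdd d)).mul
    (uniformlyBounded_Bhat hbdd d)

lemma uniformlyBounded_Bt (hA : ∀ k, IsUnit (S.A k)) (hbdd : S.IsBounded) (d : ℕ) :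
    UniformlyBounded fun t => S.Bt d t :=
  ((UniformlyBounded.const _).mul (uniformlyBounded_inv_Ahat hA hbdd d)).mul
    (uniformlyBounded_Bhat hbdd d)

lemma uniformlyBounded_Rt (hQ : ∀ k, (S.Q k).PosSemidef) (hA : ∀ k, IsUnit (S.A k))
    (hbdd : S.IsBounded) (d : ℕ) : UniformlyBounded fun t => S.Rt d t :=
  (uniformlyBounded_Rdiag hbdd d).add
    ((uniformlyBounded_Del hQ hA hbdd d).transpose.mul (uniformlyBounded_Del hQ hA hbdd d))

lemma Rdiag_posDef (hR : ∀ k, (S.R k).PosDef) (d t : ℕ) : (S.Rdiag d t).PosDef := by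
  refine posDef_of_quad (isHermitian_of_transpose_eq ?_) fun x hx => ?_
  · ext ⟨i, a⟩ ⟨j, b⟩
    simp only [Rdiag, Matrix.transpose_apply, Matrix.of_apply]
    by_cases h : i = j
    · subst h
      simpa using congrFun (congrFun (transpose_eq_of_isHermitian (hR (d * t + i)).isHermitian) a) b
    · simp [h, Ne.symm h]
  · have e : x ⬝ᵥ (S.Rdiag d t *ᵥ x) =
        ∑ i : Fin d, (fun a => x (i, a)) ⬝ᵥ (S.R (d * t + i) *ᵥ fun a => x (i, a)) := by
      simp only [dotProduct, mulVec, Rdiag, Matrix.of_apply, Fintype.sum_prod_type]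
      refine Finset.sum_congr rfl fun i _ => Finset.sum_congr rfl fun a _ => ?_
      congr 1
      rw [Finset.sum_eq_single i (by intro j _ hj; simp [hj.symm]) (by simp)]
      simp
    obtain ⟨⟨i, a⟩, hia⟩ : ∃ p, x p ≠ 0 := by
      by_contra! h
      exact hx (funext h)
    rw [e]
    refine Finset.sum_pos' (fun i _ => (hR _).posSemidef.quad_nonneg _)
      ⟨i, Finset.mem_univ _, (hR _).quad_pos fun h => hia (congrFun h a)⟩

lemma Rt_posDef (hR : ∀ k, (S.R k).PosDef) (d t : ℕ) : (S.Rt d t).PosDef :=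
  (Rdiag_posDef hR d t).add_posSemidef (posSemidef_transpose_mul_self _)

lemma Qt_eq (d t : ℕ) : S.Qt d t = (S.Xi d t)ᵀ * S.Xi d t -
    ((S.Del d t)ᵀ * S.Xi d t)ᵀ * (S.Rt d t)⁻¹ * ((S.Del d t)ᵀ * S.Xi d t) := by
  rw [Qt, transpose_mul, transpose_transpose]
  simp only [Matrix.mul_assoc]

lemma Qt_isHermitian (hR : ∀ k, (S.R k).PosDef) (d t : ℕ) : (S.Qt d t).IsHermitian := by
  rw [Qt_eq]
  exact (posSemidef_transpose_mul_self _).isHermitian.sub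
    (posSemidef_conj (Rt_posDef hR d t).inv.posSemidef _).isHermitian

lemma Qt_quad_le (hR : ∀ k, (S.R k).PosDef) (d t : ℕ) (x : Fin n → ℝ) :
    x ⬝ᵥ (S.Qt d t *ᵥ x) ≤ x ⬝ᵥ (((S.Xi d t)ᵀ * S.Xi d t) *ᵥ x) := by
  have := (posSemidef_conj (Rt_posDef hR d t).inv.posSemidef
    ((S.Del d t)ᵀ * S.Xi d t)).quad_nonneg x
  rw [Qt_eq, sub_mulVec, dotProduct_sub]
  linarith

/-! ### The determinant of the lifted dynamics -/

lemma Chat_mul_mul_Bhat_eq_zero {d t : ℕ} {M : Matrix (Fin (d + 1) × Fin n) (Fin (d + 1) × Fin n) ℝ}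
    {i j : Fin d} (h : ∀ c e, M (i.castSucc, c) (j.succ, e) = 0) (a : Fin n) (b : Fin m) :
    (S.Chat d t * M * S.Bhat d t) (i, a) (j, b) = 0 := by
  simp only [Matrix.mul_apply, Chat, Bhat, Matrix.of_apply]
  refine Finset.sum_eq_zero fun q _ => ?_
  by_cases hq : (q.1 : ℕ) = j + 1
  · rw [Finset.sum_eq_zero, zero_mul]
    intro p _
    by_cases hp : (i : ℕ) = p.1
    · obtain ⟨p1, p2⟩ := p
      obtain ⟨q1, q2⟩ := q
      obtain rfl : p1 = i.castSucc := by ext; simpa using hp.symm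
      obtain rfl : q1 = j.succ := by ext; simpa using hq
      rw [h, mul_zero]
    · rw [if_neg hp, zero_mul]
  · rw [if_neg hq, mul_zero]

/-- The matrix `Δ - Ξ Φ⁻¹ Γ` is block upper triangular while `Δ` is strictly block lower
triangular, so `Δ' (Δ - Ξ Φ⁻¹ Γ)` is strictly block upper triangular and does not contribute to
the determinant. -/
lemma det_Rdiag_add (hA : ∀ k, IsUnit (S.A k)) (d t : ℕ) :
    (S.Rdiag d t + (S.Del d t)ᵀ * (S.Del d t - S.Xi d t * (S.Phi d t)⁻¹ * S.Gam d t)).det =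
      (S.Rdiag d t).det := by
  have hlow : ∀ (i j : Fin d) (a : Fin n) (b : Fin m), i ≤ j → S.Del d t (i, a) (j, b) = 0 := by
    intro i j a b hij
    refine Chat_mul_mul_Bhat_eq_zero (fun c e => ?_) a b
    have : ¬ j.succ ≤ i.castSucc := by
      rw [Fin.le_def, Fin.val_castSucc, Fin.val_succ]; rw [Fin.le_def] at hij; omega
    rw [inv_Ahat hA, Matrix.of_apply, if_neg this]
  have hup : ∀ (i j : Fin d) (a : Fin n) (b : Fin m), j < i →
      (S.Del d t - S.Xi d t * (S.Phi d t)⁻¹ * S.Gam d t) (i, a) (j, b) = 0 := by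
    intro i j a b hij
    have e : S.Del d t - S.Xi d t * (S.Phi d t)⁻¹ * S.Gam d t = S.Chat d t *
        ((S.Ahat d t)⁻¹ - ((S.Ahat d t)⁻¹ * firstBlock n d) * (S.Phi d t)⁻¹ *
          (lastBlock n d * (S.Ahat d t)⁻¹)) * S.Bhat d t := by
      rw [Del, Xi, Gam, Matrix.mul_sub, Matrix.sub_mul]
      simp only [Matrix.mul_assoc]
    rw [e]
    refine Chat_mul_mul_Bhat_eq_zero (fun c f => ?_) a b
    have hle : j.succ ≤ i.castSucc := by
      rw [Fin.le_def, Fin.val_castSucc, Fin.val_succ]; rw [Fin.lt_def] at hij; omega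
    have e1 : ∀ p b, ((S.Ahat d t)⁻¹ * firstBlock n d) p b = S.Theta (d * t) p.1 p.2 b := by
      intro p b
      rw [mul_firstBlock_apply, inv_Ahat hA]
      simp [Theta]
    have e2 : ∀ a q, (lastBlock n d * (S.Ahat d t)⁻¹) a q =
        (S.Theta (d * t) d * (S.Theta (d * t) q.1)⁻¹) a q.2 := by
      intro a q
      rw [lastBlock_mul_apply, inv_Ahat hA]
      simp [Fin.le_last]
    have e3 : (((S.Ahat d t)⁻¹ * firstBlock n d) * (S.Phi d t)⁻¹ *
          (lastBlock n d * (S.Ahat d t)⁻¹)) (i.castSucc, c) (j.succ, f) =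
        (S.Theta (d * t) i * (S.Theta (d * t) d)⁻¹ *
          (S.Theta (d * t) d * (S.Theta (d * t) (j + 1))⁻¹)) c f := by
      rw [Phi_eq hA, Matrix.mul_assoc, Matrix.mul_apply, Matrix.mul_assoc (S.Theta (d * t) i),
        Matrix.mul_apply]
      refine Finset.sum_congr rfl fun x _ => ?_
      rw [e1, Matrix.mul_apply, Matrix.mul_apply]
      simp only [e2, Fin.val_castSucc, Fin.val_succ]
    rw [Matrix.sub_apply, e3, inv_Ahat hA, Matrix.of_apply, if_pos hle, Matrix.mul_assoc,
      nonsing_inv_mul_cancel_left _ _ (isUnit_det_Theta hA _ _)]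
    simp
  have hprod : ∀ (k j : Fin d) (a b : Fin m), j ≤ k →
      ((S.Del d t)ᵀ * (S.Del d t - S.Xi d t * (S.Phi d t)⁻¹ * S.Gam d t)) (k, a) (j, b) = 0 := by
    intro k j a b hjk
    rw [Matrix.mul_apply]
    refine Finset.sum_eq_zero fun p _ => ?_
    obtain ⟨i, c⟩ := p
    rcases le_or_gt i k with h | h
    · rw [Matrix.transpose_apply, hlow i k c a h, zero_mul]
    · rw [hup i j c b (hjk.trans_lt h), mul_zero]
  have hdiag : ∀ (k j : Fin d) (a b : Fin m), k ≠ j → S.Rdiag d t (k, a) (j, b) = 0 := by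
    intro k j a b hkj
    simp [Rdiag, hkj]
  rw [BlockTriangular.det_fintype (b := Prod.fst), BlockTriangular.det_fintype (b := Prod.fst)]
  · refine Finset.prod_congr rfl fun k _ => ?_
    congr 1
    ext ⟨⟨i, a⟩, hi⟩ ⟨⟨j, b⟩, hj⟩
    simp only at hi hj
    subst hi
    simp [toSquareBlock_def, hprod i j a b hj.le]
  · rintro ⟨i, a⟩ ⟨j, b⟩ hij
    exact hdiag i j a b (ne_of_gt hij)
  · rintro ⟨i, a⟩ ⟨j, b⟩ hij
    rw [Matrix.add_apply, hdiag i j a b (ne_of_gt hij), hprod i j a b (le_of_lt hij), add_zero]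

lemma det_At_mul_det_Rt (hA : ∀ k, IsUnit (S.A k)) (hR : ∀ k, (S.R k).PosDef) (d t : ℕ) :
    (S.Rt d t).det * (S.At d t).det = (S.Phi d t).det * (S.Rdiag d t).det := by
  obtain ⟨iR⟩ := (Rt_posDef hR d t).isUnit.nonempty_invertible
  have hPhi : IsUnit (S.Phi d t) := by rw [Phi_eq hA]; exact isUnit_Theta hA _ _
  obtain ⟨iP⟩ := hPhi.nonempty_invertible
  have h1 := det_fromBlocks₁₁ (S.Rt d t) ((S.Del d t)ᵀ * S.Xi d t) (S.Gam d t) (S.Phi d t)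
  have h2 := det_fromBlocks₂₂ (S.Rt d t) ((S.Del d t)ᵀ * S.Xi d t) (S.Gam d t) (S.Phi d t)
  rw [h1, invOf_eq_nonsing_inv, invOf_eq_nonsing_inv] at h2
  have e1 : S.At d t = S.Phi d t - S.Gam d t * (S.Rt d t)⁻¹ * ((S.Del d t)ᵀ * S.Xi d t) := by
    rw [At, Matrix.mul_assoc _ (S.Del d t)ᵀ]
  have e2 : S.Rt d t - (S.Del d t)ᵀ * S.Xi d t * (S.Phi d t)⁻¹ * S.Gam d t =
      S.Rdiag d t + (S.Del d t)ᵀ * (S.Del d t - S.Xi d t * (S.Phi d t)⁻¹ * S.Gam d t) := by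
    rw [Rt, Matrix.mul_sub]
    simp only [Matrix.mul_assoc]
    abel
  rw [e1, h2, e2, det_Rdiag_add hA]

/-- The determinant of the lifted dynamics `Ã_t` is bounded. No uniform lower bound on `R_k` enters,
since `det Ã_t = det Φ_t det R_t / det R̃_t` with `R_t ≤ R̃_t`. -/
lemma exists_abs_det_At_le (hA : ∀ k, IsUnit (S.A k)) (hR : ∀ k, (S.R k).PosDef)
    (hbdd : S.IsBounded) (d : ℕ) : ∃ c, ∀ t, |(S.At d t).det| ≤ c := by
  obtain ⟨c, hc⟩ := (uniformlyBounded_Theta hbdd (fun t => d * t) d).bounded_of_continuous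
    (φ := det) continuous_id.matrix_det
  refine ⟨c, fun t => ?_⟩
  have hpos := (Rt_posDef hR d t).det_pos
  have hpos' := (Rdiag_posDef hR d t).det_pos
  have hle : (S.Rdiag d t).det ≤ (S.Rt d t).det := (Rdiag_posDef hR d t).det_le_det_add _
  have h := congrArg abs (det_At_mul_det_Rt hA hR d t)
  rw [abs_mul, abs_mul, abs_of_pos hpos, abs_of_pos hpos', Phi_eq hA] at h
  have h1 : |(S.Theta (d * t) d).det| ≤ c := hc t
  refine le_trans ?_ h1
  refine le_of_mul_le_mul_left ?_ hpos
  rw [h, mul_comm]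
  exact mul_le_mul_of_nonneg_right hle (abs_nonneg _)

end LQRData

/-! ### Uniform positivity and boundedness of the lifted problem -/

namespace Matrix

variable {ι : Type*} [Fintype ι] [DecidableEq ι]

lemma norm_inv_le_of_quad_ge {M : Matrix ι ι ℝ} (hM : M.IsHermitian) {q : ℝ} (hq : 0 < q)
    (h : ∀ x : ι → ℝ, q * (x ⬝ᵥ x) ≤ x ⬝ᵥ (M *ᵥ x)) : ‖M⁻¹‖ ≤ q⁻¹ := by
  have hpd := posDef_of_quad_ge hM hq h
  refine hpd.inv.posSemidef.norm_le (by positivity) fun x => ?_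
  have h1 : q • (1 : Matrix ι ι ℝ) ≤ M :=
    le_of_quad (isHermitian_smul isHermitian_one q) hM fun x => by
      rw [quad_smul, one_mulVec]; exact h x
  have h2 := quad_mono ((PosDef.one.smul hq).inv_anti h1) x
  rwa [inv_smul_real _ isUnit_one hq.ne', inv_one, quad_smul, one_mulVec] at h2

lemma PosDef.quad_inv_ge {M : Matrix ι ι ℝ} (hM : M.PosDef) {c : ℝ} (hc : 0 < c)
    (h : ‖M‖ ≤ c) (x : ι → ℝ) : c⁻¹ * (x ⬝ᵥ x) ≤ x ⬝ᵥ (M⁻¹ *ᵥ x) := by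
  have h1 : M ≤ c • (1 : Matrix ι ι ℝ) :=
    le_of_quad hM.isHermitian (isHermitian_smul isHermitian_one c) fun x => by
      rw [quad_smul, one_mulVec]
      exact (quad_le_norm M x).trans (mul_le_mul_of_nonneg_right h (dotProduct_self_nonneg' x))
  have h2 := quad_mono (hM.inv_anti h1) x
  rwa [inv_smul_real _ isUnit_one hc.ne', inv_one, quad_smul, one_mulVec] at h2

lemma PosDef.norm_pos [Nonempty ι] {M : Matrix ι ι ℝ} (hM : M.PosDef) : 0 < ‖M‖ := by
  refine norm_pos_iff.2 fun h0 => ?_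
  have := hM.diag_pos (i := Classical.arbitrary ι)
  rw [h0] at this
  exact lt_irrefl _ this

end Matrix

namespace LQRData

variable {n m : ℕ} {S : LQRData n m} {d : ℕ}

/-- The properties of the lifted problem on which the analysis of its Riccati recursion rests. The
matrix in `exists_le_eps` is the one whose least eigenvalue is `ε_t`. -/
structure IsRegular (S : LQRData n m) (d : ℕ) : Prop where
  posDef_Rt : ∀ t, (S.Rt d t).PosDef
  posDef_Qt : ∀ t, (S.Qt d t).PosDef
  posDef_Bt : ∀ t, (S.Bt d t * (S.Bt d t)ᵀ).PosDef
  isUnit_At : ∀ t, IsUnit (S.At d t)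
  exists_le_Qt : ∃ q, 0 < q ∧ ∀ t x, q * (x ⬝ᵥ x) ≤ x ⬝ᵥ (S.Qt d t *ᵥ x)
  exists_le_eps : ∃ c, 0 < c ∧ ∀ t x, c * (x ⬝ᵥ x) ≤ x ⬝ᵥ (((S.At d t)⁻¹ * S.Bt d t
    * (S.Rt d t + (S.Bt d t)ᵀ * ((S.At d t)ᵀ)⁻¹ * S.Qt d t * (S.At d t)⁻¹ * S.Bt d t)⁻¹
    * (S.Bt d t)ᵀ * ((S.At d t)ᵀ)⁻¹) *ᵥ x)
  bounded_termPen : UniformlyBounded (S.termPen d)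

lemma isUnit_At_of_isUniform (hunif : S.IsUniform d) (t : ℕ) : IsUnit (S.At d t) := by
  have h := posDef_of_quad_ge (M := S.At d t * (S.At d t)ᵀ)
    (isHermitian_of_transpose_eq (by rw [transpose_mul, transpose_transpose])) hunif.2.2
    (iInf_lambdaMin_mul_le hunif.2.2 t)
  have hdet := (isUnit_iff_isUnit_det _).1 h.isUnit
  rw [det_mul] at hdet
  exact (isUnit_iff_isUnit_det _).2 (isUnit_of_mul_isUnit_left hdet)

lemma uniformlyBounded_inv_At (hunif : S.IsUniform d) :
    UniformlyBounded fun t => (S.At d t)⁻¹ := by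
  set a := ⨅ t, lambdaMin (S.At d t * (S.At d t)ᵀ) with ha
  have ha0 : 0 < a := hunif.2.2
  refine ⟨√a⁻¹, fun t => Real.le_sqrt_of_sq_le ?_⟩
  have hdet := (isUnit_iff_isUnit_det _).1 (isUnit_At_of_isUniform hunif t)
  rw [← norm_transpose_real, transpose_nonsing_inv]
  refine norm_sq_le_of_mulVec (by positivity) fun y => ?_
  have h := iInf_lambdaMin_mul_le hunif.2.2 t (((S.At d t)ᵀ)⁻¹ *ᵥ y)
  have hq := quad_sq (S.At d t)ᵀ (((S.At d t)ᵀ)⁻¹ *ᵥ y)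
  have hy : (S.At d t)ᵀ *ᵥ (((S.At d t)ᵀ)⁻¹ *ᵥ y) = y := by
    rw [mulVec_mulVec, mul_nonsing_inv _ (by rwa [det_transpose]), one_mulVec]
  rw [transpose_transpose, hy] at hq
  rw [hq, ← ha] at h
  rwa [inv_mul_eq_div, le_div_iff₀' ha0]

lemma uniformlyBounded_At (hA : ∀ k, IsUnit (S.A k)) (hR : ∀ k, (S.R k).PosDef)
    (hbdd : S.IsBounded) (hunif : S.IsUniform d) : UniformlyBounded fun t => S.At d t := by
  obtain ⟨c, hc⟩ := exists_abs_det_At_le hA hR hbdd d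
  exact .of_inv_of_det (isUnit_At_of_isUniform hunif) (uniformlyBounded_inv_At hunif) hc

lemma termPen_eq (d s : ℕ) : S.termPen d s = S.Qt d s +
    (deadbeatGain (S.At d s) (S.Bt d s))ᵀ * S.Rt d s * deadbeatGain (S.At d s) (S.Bt d s) := by
  have h : ((S.Bt d s * (S.Bt d s)ᵀ)⁻¹)ᵀ = (S.Bt d s * (S.Bt d s)ᵀ)⁻¹ := by
    rw [transpose_nonsing_inv, transpose_mul, transpose_transpose]
  rw [termPen, deadbeatGain, transpose_mul, transpose_mul, transpose_transpose, h]
  simp only [Matrix.mul_assoc]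

/-- The bound behind `exists_le_eps` is `x' E x ≥ |G' x|² / ‖R̃ + G' Q̃ G‖` for `G = Ã⁻¹ B̃`, in which
`|G' x|` is bounded below because `Ã` is bounded. -/
lemma isRegular (hQ : ∀ k, (S.Q k).PosSemidef) (hR : ∀ k, (S.R k).PosDef) (hbdd : S.IsBounded)
    (hA : ∀ k, IsUnit (S.A k)) (hunif : S.IsUniform d) : S.IsRegular d := by
  have hAu := isUnit_At_of_isUniform hunif
  have hAinv := uniformlyBounded_inv_At hunif
  have hAb := uniformlyBounded_At hA hR hbdd hunif
  have hBb := uniformlyBounded_Bt hA hbdd d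
  have hRb := uniformlyBounded_Rt hQ hA hbdd d
  have hRpd := Rt_posDef hR d
  have hQh := Qt_isHermitian hR d
  have hQpd : ∀ t, (S.Qt d t).PosDef := fun t =>
    posDef_of_quad_ge (hQh t) hunif.1 (iInf_lambdaMin_mul_le hunif.1 t)
  have hQb : UniformlyBounded fun t => S.Qt d t :=
    .of_quad_le (fun t => (hQpd t).posSemidef)
      ((uniformlyBounded_Xi hQ hA hbdd d).transpose.mul (uniformlyBounded_Xi hQ hA hbdd d))
      (Qt_quad_le hR d)
  have hBBh : ∀ t, (S.Bt d t * (S.Bt d t)ᵀ).IsHermitian := fun t =>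
    isHermitian_of_transpose_eq (by rw [transpose_mul, transpose_transpose])
  have hBpd : ∀ t, (S.Bt d t * (S.Bt d t)ᵀ).PosDef := fun t =>
    posDef_of_quad_ge (hBBh t) hunif.2.1 (iInf_lambdaMin_mul_le hunif.2.1 t)
  have hBBinv : UniformlyBounded fun t => (S.Bt d t * (S.Bt d t)ᵀ)⁻¹ :=
    ⟨_, fun t => norm_inv_le_of_quad_ge (hBBh t) hunif.2.1 (iInf_lambdaMin_mul_le hunif.2.1 t)⟩
  refine ⟨hRpd, hQpd, hBpd, hAu, ⟨_, hunif.1, iInf_lambdaMin_mul_le hunif.1⟩, ?_, ?_⟩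
  · set b := ⨅ t, lambdaMin (S.Bt d t * (S.Bt d t)ᵀ) with hb
    have hb0 : 0 < b := hunif.2.1
    have hGb : UniformlyBounded fun t => (S.At d t)⁻¹ * S.Bt d t := hAinv.mul hBb
    obtain ⟨c, hc0, hc⟩ :=
      (hRb.add ((hGb.transpose.mul hQb).mul hGb)).exists_pos
    obtain ⟨α, hα0, hα⟩ := hAb.exists_pos
    refine ⟨c⁻¹ * (b * (α ^ 2)⁻¹), by positivity, fun t x => ?_⟩
    have hGT : ((S.At d t)⁻¹ * S.Bt d t)ᵀ = (S.Bt d t)ᵀ * ((S.At d t)ᵀ)⁻¹ := by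
      rw [transpose_mul, transpose_nonsing_inv]
    set G := (S.At d t)⁻¹ * S.Bt d t with hG
    have e : (S.At d t)⁻¹ * S.Bt d t
        * (S.Rt d t + (S.Bt d t)ᵀ * ((S.At d t)ᵀ)⁻¹ * S.Qt d t * (S.At d t)⁻¹ * S.Bt d t)⁻¹
        * (S.Bt d t)ᵀ * ((S.At d t)ᵀ)⁻¹ =
        (Gᵀ)ᵀ * (S.Rt d t + Gᵀ * S.Qt d t * G)⁻¹ * Gᵀ := by
      rw [transpose_transpose, hGT, hG]; simp only [Matrix.mul_assoc]
    rw [e, quad_conj]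
    refine le_trans ?_ ((posDef_add_conj (hRpd t) (hQpd t).posSemidef).quad_inv_ge hc0 (hc t) _)
    rw [mul_assoc]
    refine mul_le_mul_of_nonneg_left ?_ (by positivity)
    have hdet : IsUnit ((S.At d t)ᵀ).det := by
      rw [det_transpose]; exact (isUnit_iff_isUnit_det _).1 (hAu t)
    set v := ((S.At d t)ᵀ)⁻¹ *ᵥ x with hv
    have hx : (S.At d t)ᵀ *ᵥ v = x := by
      rw [hv, mulVec_mulVec, mul_nonsing_inv _ hdet, one_mulVec]
    have h1 : x ⬝ᵥ x ≤ α ^ 2 * (v ⬝ᵥ v) := by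
      rw [← hx]
      refine (mulVec_sq_le _ _).trans (mul_le_mul_of_nonneg_right ?_ (dotProduct_self_nonneg' v))
      rw [norm_transpose_real]
      exact pow_le_pow_left₀ (norm_nonneg _) (hα t) 2
    have h2 : b * (v ⬝ᵥ v) ≤ (Gᵀ *ᵥ x) ⬝ᵥ (Gᵀ *ᵥ x) := by
      rw [hGT, ← mulVec_mulVec, ← hv, ← quad_sq (S.Bt d t)ᵀ v, transpose_transpose]
      exact iInf_lambdaMin_mul_le hunif.2.1 t v
    refine le_trans ?_ h2
    rw [mul_assoc, inv_mul_eq_div]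
    exact mul_le_mul_of_nonneg_left ((div_le_iff₀' (by positivity)).2 h1) hb0.le
  · have hL : UniformlyBounded fun t => deadbeatGain (S.At d t) (S.Bt d t) :=
      (hBb.transpose.mul hBBinv).mul hAb
    have := hQb.add ((hL.transpose.mul hRb).mul hL)
    simpa only [← termPen_eq] using this

/-! ### The contraction constants -/

namespace IsRegular

lemma exists_zeta_eq (h : S.IsRegular d) (t : ℕ) : ∃ M : Matrix (Fin n) (Fin n) ℝ,
    M.PosSemidef ∧ S.zeta d t = ‖(S.Qt d t + M)⁻¹‖ := by
  refine ⟨_, posSemidef_conj' (h.posDef_Rt t).inv.posSemidef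
    (S.Qt d t * (S.At d t)⁻¹ * S.Bt d t), ?_⟩
  rw [zeta, transpose_mul, transpose_mul, transpose_nonsing_inv,
    transpose_eq_of_isHermitian (h.posDef_Qt t).isHermitian]
  simp only [Matrix.mul_assoc]

lemma exists_zeta_le (h : S.IsRegular d) : ∃ c, ∀ t, S.zeta d t ≤ c := by
  obtain ⟨q, hq0, hq⟩ := h.exists_le_Qt
  refine ⟨q⁻¹, fun t => ?_⟩
  obtain ⟨M, hM, e⟩ := h.exists_zeta_eq t
  rw [e]
  refine norm_inv_le_of_quad_ge ((h.posDef_Qt t).isHermitian.add hM.isHermitian) hq0 fun x => ?_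
  rw [add_mulVec, dotProduct_add]
  linarith [hq t x, hM.quad_nonneg x]

lemma zeta_pos (hn : 0 < n) (h : S.IsRegular d) (t : ℕ) : 0 < S.zeta d t := by
  have : Nonempty (Fin n) := ⟨⟨0, hn⟩⟩
  obtain ⟨M, hM, e⟩ := h.exists_zeta_eq t
  rw [e]
  exact ((h.posDef_Qt t).add_posSemidef hM).inv.norm_pos

lemma bddAbove_zeta (h : S.IsRegular d) : BddAbove (range (S.zeta d)) := by
  obtain ⟨c, hc⟩ := h.exists_zeta_le
  exact ⟨c, by rintro _ ⟨t, rfl⟩; exact hc t⟩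

lemma zetaSup_pos (hn : 0 < n) (h : S.IsRegular d) : 0 < S.zetaSup d :=
  (h.zeta_pos hn 0).trans_le (le_ciSup h.bddAbove_zeta 0)

lemma exists_le_eps_const (hn : 0 < n) (h : S.IsRegular d) : ∃ c, 0 < c ∧ ∀ t, c ≤ S.eps d t := by
  have : Nonempty (Fin n) := ⟨⟨0, hn⟩⟩
  obtain ⟨c, hc0, hc⟩ := h.exists_le_eps
  exact ⟨c, hc0, fun t => le_lambdaMin (hc t)⟩

lemma epsInf_pos (hn : 0 < n) (h : S.IsRegular d) : 0 < S.epsInf d := by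
  obtain ⟨c, hc0, hc⟩ := h.exists_le_eps_const hn
  exact hc0.trans_le (le_ciInf hc)

lemma epsInf_le (hn : 0 < n) (h : S.IsRegular d) (t : ℕ) : S.epsInf d ≤ S.eps d t := by
  obtain ⟨c, hc0, hc⟩ := h.exists_le_eps_const hn
  exact ciInf_le ⟨c, by rintro _ ⟨t, rfl⟩; exact hc t⟩ t

lemma rate_nonneg (hn : 0 < n) (h : S.IsRegular d) :
    0 ≤ S.zetaSup d / (S.zetaSup d + S.epsInf d) := by
  have h1 := h.zetaSup_pos hn
  have h2 := h.epsInf_pos hn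
  positivity

lemma rate_lt_one (hn : 0 < n) (h : S.IsRegular d) :
    S.zetaSup d / (S.zetaSup d + S.epsInf d) < 1 := by
  have h1 := h.zetaSup_pos hn
  have h2 := h.epsInf_pos hn
  rw [div_lt_one (by positivity)]
  linarith

/-! ### The Riccati recursion of the lifted problem -/

lemma le_ric (h : S.IsRegular d) (t : ℕ) {P : Matrix (Fin n) (Fin n) ℝ}
    (hP : P.PosSemidef) : S.Qt d t ≤ S.ric d t P :=
  le_riccati (h.posDef_Qt t).isHermitian (h.posDef_Rt t) hP

lemma ric_posDef (h : S.IsRegular d) (t : ℕ) {P : Matrix (Fin n) (Fin n) ℝ}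
    (hP : P.PosSemidef) : (S.ric d t P).PosDef :=
  (h.posDef_Qt t).of_le (h.le_ric t hP)

lemma ric_mono (h : S.IsRegular d) (t : ℕ) {P P' : Matrix (Fin n) (Fin n) ℝ}
    (hP : P.PosSemidef) (hle : P ≤ P') : S.ric d t P ≤ S.ric d t P' :=
  riccati_mono (h.posDef_Qt t).isHermitian (h.posDef_Rt t) hP hle

lemma ric_le_termPen (h : S.IsRegular d) (t : ℕ) {P : Matrix (Fin n) (Fin n) ℝ}
    (hP : P.PosSemidef) : S.ric d t P ≤ S.termPen d t := by
  rw [termPen_eq]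
  exact riccati_le_deadbeat (h.posDef_Qt t).isHermitian (h.posDef_Rt t) hP (h.posDef_Bt t)

lemma termPen_posDef (h : S.IsRegular d) (t : ℕ) : (S.termPen d t).PosDef :=
  (h.ric_posDef t .zero).of_le (h.ric_le_termPen t .zero)

lemma ric_le_exp_smul (hn : 0 < n) (h : S.IsRegular d) (t : ℕ) {P P' : Matrix (Fin n) (Fin n) ℝ}
    (hP : P.PosDef) (hP' : P'.PosDef) {δ : ℝ} (hδ : 0 ≤ δ) (hle : P' ≤ Real.exp δ • P) :
    S.ric d t P' ≤
      Real.exp (S.zetaSup d / (S.zetaSup d + S.epsInf d) * δ) • S.ric d t P :=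
  riccati_le_exp_smul (h.isUnit_At t) (h.posDef_Qt t) (h.posDef_Rt t) hP hP' (h.zetaSup_pos hn)
    (h.epsInf_pos hn) hδ (le_ciSup h.bddAbove_zeta t)
    (fun x => (mul_le_mul_of_nonneg_right (h.epsInf_le hn t) (dotProduct_self_nonneg' x)).trans
      (lambdaMin_mul_le _ x)) hle

end IsRegular

lemma ricIter_add (d t k l : ℕ) (X : Matrix (Fin n) (Fin n) ℝ) :
    S.ricIter d t (k + l) X = S.ricIter d t k (S.ricIter d (t + k) l X) := by
  induction k generalizing t with
  | zero => simp [ricIter]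
  | succ k ih => rw [Nat.succ_add, ricIter, ricIter, ih, add_right_comm, add_assoc]

namespace IsRegular

lemma ricIter_posDef (h : S.IsRegular d) (k t : ℕ) {X : Matrix (Fin n) (Fin n) ℝ}
    (hX : X.PosDef) : (S.ricIter d t k X).PosDef := by
  induction k generalizing t with
  | zero => exact hX
  | succ k ih => exact h.ric_posDef t (ih (t + 1)).posSemidef

lemma ricIter_mono (h : S.IsRegular d) (k t : ℕ) {X Y : Matrix (Fin n) (Fin n) ℝ}
    (hX : X.PosDef) (hle : X ≤ Y) : S.ricIter d t k X ≤ S.ricIter d t k Y := by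
  induction k generalizing t with
  | zero => exact hle
  | succ k ih => exact h.ric_mono t (h.ricIter_posDef k (t + 1) hX).posSemidef (ih (t + 1))

lemma ricIter_le_exp_smul (hn : 0 < n) (h : S.IsRegular d) (k t : ℕ)
    {P P' : Matrix (Fin n) (Fin n) ℝ} (hP : P.PosDef) (hP' : P'.PosDef) {δ : ℝ} (hδ : 0 ≤ δ)
    (hle : P' ≤ Real.exp δ • P) :
    S.ricIter d t k P' ≤
      Real.exp ((S.zetaSup d / (S.zetaSup d + S.epsInf d)) ^ k * δ) • S.ricIter d t k P := by
  induction k generalizing t with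
  | zero => simpa [ricIter] using hle
  | succ k ih =>
    rw [pow_succ', mul_assoc]
    exact h.ric_le_exp_smul hn t (h.ricIter_posDef k _ hP) (h.ricIter_posDef k _ hP')
      (mul_nonneg (pow_nonneg (h.rate_nonneg hn) k) hδ) (ih (t + 1))

/-- Value iteration from the terminal penalties is decreasing in the horizon. -/
lemma ricIter_succ_termPen_le (h : S.IsRegular d) (t k : ℕ) :
    S.ricIter d t (k + 1) (S.termPen d (t + (k + 1))) ≤
      S.ricIter d t k (S.termPen d (t + k)) := by
  rw [ricIter_add]
  exact h.ricIter_mono k t (h.ricIter_posDef 1 _ (h.termPen_posDef _))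
    (h.ric_le_termPen _ (h.termPen_posDef _).posSemidef)

end IsRegular

/-! ### The bounded solution of the Riccati recursion -/

lemma IsRiccatiSolution.eq_ricIter {P : ℕ → Matrix (Fin n) (Fin n) ℝ}
    (hP : S.IsRiccatiSolution d P) (t k : ℕ) : P t = S.ricIter d t k (P (t + k)) := by
  induction k with
  | zero => rfl
  | succ k ih => rw [ricIter_add, ← add_assoc]; rw [ih]; congr 1; exact hP.2.2 _

namespace IsRegular

lemma posDef_of_isRiccatiSolution (h : S.IsRegular d) {P : ℕ → Matrix (Fin n) (Fin n) ℝ}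
    (hP : S.IsRiccatiSolution d P) (t : ℕ) : (P t).PosDef := by
  rw [hP.2.2 t]
  exact h.ric_posDef t (hP.1 _)

lemma Qt_le_of_isRiccatiSolution (h : S.IsRegular d) {P : ℕ → Matrix (Fin n) (Fin n) ℝ}
    (hP : S.IsRiccatiSolution d P) (t : ℕ) : S.Qt d t ≤ P t := by
  rw [hP.2.2 t]
  exact h.le_ric t (hP.1 _)

/-- Bounded solutions are comparable up to a constant factor `exp δ`, and `k` steps of the
contraction reduce the factor to `exp (ρ ^ k δ)`. -/
lemma isRiccatiSolution_le (hn : 0 < n) (h : S.IsRegular d)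
    {P P' : ℕ → Matrix (Fin n) (Fin n) ℝ} (hP : S.IsRiccatiSolution d P)
    (hP' : S.IsRiccatiSolution d P') (t : ℕ) : P' t ≤ P t := by
  obtain ⟨q, hq0, hq⟩ := h.exists_le_Qt
  obtain ⟨c, hc⟩ := hP'.2.1
  set r := S.zetaSup d / (S.zetaSup d + S.epsInf d) with hr
  set δ := Real.log (max (c / q) 1) with hδ
  have hδ0 : 0 ≤ δ := Real.log_nonneg (le_max_right _ _)
  have hcomp : ∀ s, P' s ≤ Real.exp δ • P s := by
    intro s
    refine le_of_quad (hP'.1 s).isHermitian (isHermitian_smul (hP.1 s).isHermitian _) fun x => ?_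
    rw [quad_smul, hδ, Real.exp_log (by positivity)]
    have h1 : ‖P' s‖ ≤ c := hc ⟨s, rfl⟩
    have h2 := (hq s x).trans (quad_mono (h.Qt_le_of_isRiccatiSolution hP s) x)
    have h3 := dotProduct_self_nonneg' x
    calc x ⬝ᵥ (P' s *ᵥ x) ≤ c * (x ⬝ᵥ x) :=
          (quad_le_norm _ x).trans (mul_le_mul_of_nonneg_right h1 h3)
      _ = c / q * (q * (x ⬝ᵥ x)) := by field_simp
      _ ≤ max (c / q) 1 * (q * (x ⬝ᵥ x)) :=
          mul_le_mul_of_nonneg_right (le_max_left _ _) (by positivity)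
      _ ≤ _ := mul_le_mul_of_nonneg_left h2 (by positivity)
  refine le_of_quad (hP'.1 t).isHermitian (hP.1 t).isHermitian fun x => ?_
  have hk : ∀ k, x ⬝ᵥ (P' t *ᵥ x) ≤ Real.exp (r ^ k * δ) * (x ⬝ᵥ (P t *ᵥ x)) := by
    intro k
    have := h.ricIter_le_exp_smul hn k t (h.posDef_of_isRiccatiSolution hP (t + k))
      (h.posDef_of_isRiccatiSolution hP' (t + k)) hδ0 (hcomp _)
    rw [← hP.eq_ricIter, ← hP'.eq_ricIter] at this
    have := quad_mono this x
    rwa [quad_smul] at this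
  have hlim : Tendsto (fun k => Real.exp (r ^ k * δ) * (x ⬝ᵥ (P t *ᵥ x))) atTop
      (𝓝 (Real.exp (0 * δ) * (x ⬝ᵥ (P t *ᵥ x)))) :=
    ((Real.continuous_exp.tendsto _).comp ((tendsto_pow_atTop_nhds_zero_of_lt_one
      (h.rate_nonneg hn) (h.rate_lt_one hn)).mul_const δ)).mul_const _
  simpa using ge_of_tendsto' hlim hk

lemma continuousAt_ric (h : S.IsRegular d) (t : ℕ) {P : Matrix (Fin n) (Fin n) ℝ}
    (hP : P.PosSemidef) : ContinuousAt (S.ric d t) P := by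
  have hS := posDef_add_conj (B := S.Bt d t) (h.posDef_Rt t) hP
  have hinv : ContinuousAt (fun P : Matrix (Fin n) (Fin n) ℝ =>
      (S.Rt d t + (S.Bt d t)ᵀ * P * S.Bt d t)⁻¹) P := by
    refine ContinuousAt.comp (f := fun P : Matrix (Fin n) (Fin n) ℝ =>
      S.Rt d t + (S.Bt d t)ᵀ * P * S.Bt d t) (continuousAt_matrix_inv _ ?_) ?_
    · rw [Ring.inverse_eq_inv']
      exact continuousAt_inv₀ hS.det_pos.ne'
    · exact Continuous.continuousAt (by fun_prop)
  have hcont : Continuous fun X : Matrix (Fin n) (Fin n) ℝ ×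
      Matrix (Fin d × Fin m) (Fin d × Fin m) ℝ =>
      S.Qt d t + (S.At d t)ᵀ * (X.1 - X.1 * S.Bt d t * X.2 * (S.Bt d t)ᵀ * X.1) * S.At d t := by
    fun_prop
  exact ContinuousAt.comp (f := fun P : Matrix (Fin n) (Fin n) ℝ =>
    (P, (S.Rt d t + (S.Bt d t)ᵀ * P * S.Bt d t)⁻¹)) hcont.continuousAt (continuousAt_id.prodMk hinv)

end IsRegular

/-- A decreasing sequence of positive semidefinite matrices converges. -/
lemma _root_.Matrix.exists_tendsto_of_antitone {ι : Type*} [Fintype ι] [DecidableEq ι]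
    {F : ℕ → Matrix ι ι ℝ} (hF : ∀ k, (F k).PosSemidef) (hanti : ∀ k, F (k + 1) ≤ F k) :
    ∃ L : Matrix ι ι ℝ, L.PosSemidef ∧ L ≤ F 0 ∧ Tendsto F atTop (𝓝 L) := by
  have hq : ∀ x : ι → ℝ, ∃ l, Tendsto (fun k => x ⬝ᵥ (F k *ᵥ x)) atTop (𝓝 l) := fun x =>
    ⟨_, tendsto_atTop_ciInf (antitone_nat_of_succ_le fun k => quad_mono (hanti k) x)
      ⟨0, by rintro _ ⟨k, rfl⟩; exact (hF k).quad_nonneg x⟩⟩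
  -- the entries converge by polarization
  have hent : ∀ i j, ∃ l, Tendsto (fun k => F k i j) atTop (𝓝 l) := by
    intro i j
    obtain ⟨a, ha⟩ := hq (Pi.single i 1 + Pi.single j 1)
    obtain ⟨b, hb⟩ := hq (Pi.single i 1)
    obtain ⟨c, hc⟩ := hq (Pi.single j 1)
    refine ⟨(a - b - c) / 2, (((ha.sub hb).sub hc).div_const 2).congr fun k => ?_⟩
    have hsym : F k j i = F k i j := by
      conv_lhs => rw [← transpose_eq_of_isHermitian (hF k).isHermitian, transpose_apply]
    simp only [mulVec_add, mulVec_single_one, add_dotProduct, dotProduct_add,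
      single_one_dotProduct, col_apply]
    rw [hsym]
    ring
  choose L hL using hent
  have hlim : Tendsto F atTop (𝓝 (Matrix.of L)) :=
    tendsto_pi_nhds.2 fun i => tendsto_pi_nhds.2 fun j => hL i j
  have hquad : ∀ x : ι → ℝ,
      Tendsto (fun k => x ⬝ᵥ (F k *ᵥ x)) atTop (𝓝 (x ⬝ᵥ (Matrix.of L *ᵥ x))) := fun x =>
    (Continuous.tendsto (f := fun M : Matrix ι ι ℝ => x ⬝ᵥ (M *ᵥ x)) (by fun_prop) _).comp hlim
  have hherm : (Matrix.of L).IsHermitian := by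
    refine isHermitian_of_transpose_eq (tendsto_nhds_unique (f := F) ?_ hlim)
    refine ((continuous_id.matrix_transpose.tendsto _).comp hlim).congr fun k => ?_
    exact transpose_eq_of_isHermitian (hF k).isHermitian
  refine ⟨Matrix.of L, posSemidef_of_quad hherm fun x => ?_,
    le_of_quad hherm (hF 0).isHermitian fun x => ?_, hlim⟩
  · exact ge_of_tendsto' (hquad x) fun k => (hF k).quad_nonneg x
  · exact (antitone_nat_of_succ_le fun k => quad_mono (hanti k) x).le_of_tendsto (hquad x) 0

lemma IsRegular.existsUnique_isRiccatiSolution (hn : 0 < n) (h : S.IsRegular d) :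
    ∃! P : ℕ → Matrix (Fin n) (Fin n) ℝ, S.IsRiccatiSolution d P := by
  have hpos : ∀ t k, (S.ricIter d t k (S.termPen d (t + k))).PosDef := fun t k =>
    h.ricIter_posDef k t (h.termPen_posDef _)
  choose P hPpos hPle hPlim using fun t => exists_tendsto_of_antitone
    (fun k => (hpos t k).posSemidef) (h.ricIter_succ_termPen_le t)
  have hsol : S.IsRiccatiSolution d P := by
    refine ⟨hPpos, ?_, fun t => ?_⟩
    · obtain ⟨c, hc⟩ := UniformlyBounded.of_quad_le hPpos h.bounded_termPen
        fun t x => quad_mono (hPle t) x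
      exact ⟨c, by rintro _ ⟨t, rfl⟩; exact hc t⟩
    · refine tendsto_nhds_unique ((tendsto_add_atTop_iff_nat 1).2 (hPlim t)) ?_
      refine ((h.continuousAt_ric t (hPpos (t + 1))).tendsto.comp (hPlim (t + 1))).congr fun k => ?_
      simp only [Function.comp_apply, ricIter, add_assoc, add_comm 1 k]
  exact ⟨P, hsol, fun P' hP' => funext fun t =>
    le_antisymm (h.isRiccatiSolution_le hn hsol hP' t) (h.isRiccatiSolution_le hn hP' hsol t)⟩

end LQRData

/-! ### Costs as completed squares -/

namespace LQRData

variable {n m : ℕ} {S : LQRData n m} {d : ℕ}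

lemma traj_congr {t : ℕ} {χ : Fin n → ℝ} {w w' : ℕ → Fin d × Fin m → ℝ} {i : ℕ}
    (hw : ∀ j < i, w j = w' j) : S.traj d t χ w i = S.traj d t χ w' i := by
  induction i with
  | zero => rfl
  | succ i ih => rw [traj, traj, ih fun j hj => hw j (hj.trans i.lt_succ_self), hw i i.lt_succ_self]

/-- The cost of stage `t + i` under the inputs `w 0, w 1, …` applied from time `t` on. -/
noncomputable def stageCost (S : LQRData n m) (d t : ℕ) (χ : Fin n → ℝ) (w : ℕ → Fin d × Fin m → ℝ)
    (i : ℕ) : ℝ :=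
  S.traj d t χ w i ⬝ᵥ (S.Qt d (t + i) *ᵥ S.traj d t χ w i) + w i ⬝ᵥ (S.Rt d (t + i) *ᵥ w i)

lemma extend_apply {T : ℕ} (w : Fin T → Fin d × Fin m → ℝ) (i : Fin T) :
    extend w (i : ℕ) = w i := by
  simp [extend]

lemma cost_eq_sum (T t : ℕ) (χ : Fin n → ℝ) (w : Fin T → Fin d × Fin m → ℝ) :
    S.cost d T t χ w = ∑ i ∈ Finset.range T, S.stageCost d t χ (extend w) i := by
  rw [cost, ← Fin.sum_univ_eq_sum_range]
  simp only [stageCost, extend_apply]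

lemma partialCost_eq_sum (ξ : Fin n → ℝ) (u : ℕ → Fin d × Fin m → ℝ) (N : ℕ) :
    S.partialCost d 0 ξ u N = ∑ i ∈ Finset.range N, S.stageCost d 0 ξ u i := by
  rw [partialCost, cost_eq_sum]
  have hext : ∀ i < N, extend (fun i : Fin N => u (0 + i)) i = u i := fun i hi => by
    simp [extend, hi]
  refine Finset.sum_congr rfl fun i hi => ?_
  have hi' := Finset.mem_range.1 hi
  rw [stageCost, stageCost, traj_congr fun j hj => hext j (hj.trans hi'), hext i hi']

/-- The deviation of the `i`-th input from the feedback that is optimal for the costs-to-go `Y`,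
weighted as in the completed square. -/
noncomputable def deviation (S : LQRData n m) (d t : ℕ) (Y : ℕ → Matrix (Fin n) (Fin n) ℝ) (χ : Fin n → ℝ)
    (w : ℕ → Fin d × Fin m → ℝ) (i : ℕ) : ℝ :=
  (w i + S.gain d (t + i) (Y (i + 1)) *ᵥ S.traj d t χ w i) ⬝ᵥ
    ((S.Rt d (t + i) + (S.Bt d (t + i))ᵀ * Y (i + 1) * S.Bt d (t + i)) *ᵥ
      (w i + S.gain d (t + i) (Y (i + 1)) *ᵥ S.traj d t χ w i))

lemma deviation_of_eq {t : ℕ} {Y : ℕ → Matrix (Fin n) (Fin n) ℝ} {χ : Fin n → ℝ}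
    {w : ℕ → Fin d × Fin m → ℝ} {i : ℕ}
    (hw : w i = -(S.gain d (t + i) (Y (i + 1)) *ᵥ S.traj d t χ w i)) :
    S.deviation d t Y χ w i = 0 := by
  rw [deviation, hw, neg_add_cancel, zero_dotProduct]

namespace IsRegular

lemma deviation_nonneg (h : S.IsRegular d) (t : ℕ) {Y : ℕ → Matrix (Fin n) (Fin n) ℝ}
    (hY : ∀ i, (Y i).PosSemidef) (χ : Fin n → ℝ) (w : ℕ → Fin d × Fin m → ℝ) (i : ℕ) :
    0 ≤ S.deviation d t Y χ w i :=
  (posDef_add_conj (h.posDef_Rt _) (hY _)).posSemidef.quad_nonneg _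

lemma eq_of_deviation_eq_zero (h : S.IsRegular d) {t : ℕ} {Y : ℕ → Matrix (Fin n) (Fin n) ℝ}
    (hY : ∀ i, (Y i).PosSemidef) {χ : Fin n → ℝ} {w : ℕ → Fin d × Fin m → ℝ} {i : ℕ}
    (h0 : S.deviation d t Y χ w i = 0) :
    w i = -(S.gain d (t + i) (Y (i + 1)) *ᵥ S.traj d t χ w i) := by
  by_contra hne
  exact ((posDef_add_conj (h.posDef_Rt _) (hY _)).quad_pos
    fun h' => hne (eq_neg_of_add_eq_zero_left h')).ne' h0

lemma stageCost_nonneg (h : S.IsRegular d) (t : ℕ) (χ : Fin n → ℝ)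
    (w : ℕ → Fin d × Fin m → ℝ) (i : ℕ) : 0 ≤ S.stageCost d t χ w i :=
  add_nonneg ((h.posDef_Qt _).posSemidef.quad_nonneg _) ((h.posDef_Rt _).posSemidef.quad_nonneg _)

/-- Telescoping the completed squares along a solution `Y` of the Riccati recursion. -/
lemma sum_stageCost_add (h : S.IsRegular d) (t : ℕ) {Y : ℕ → Matrix (Fin n) (Fin n) ℝ}
    (hY : ∀ i, (Y i).PosSemidef) (χ : Fin n → ℝ) (w : ℕ → Fin d × Fin m → ℝ) (N : ℕ)
    (hrec : ∀ i < N, Y i = S.ric d (t + i) (Y (i + 1))) :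
    ∑ i ∈ Finset.range N, S.stageCost d t χ w i +
        S.traj d t χ w N ⬝ᵥ (Y N *ᵥ S.traj d t χ w N) =
      χ ⬝ᵥ (Y 0 *ᵥ χ) + ∑ i ∈ Finset.range N, S.deviation d t Y χ w i := by
  induction N with
  | zero => simp [traj]
  | succ N ih =>
    have ih := ih fun i hi => hrec i (hi.trans N.lt_succ_self)
    have hsq : S.stageCost d t χ w N +
        S.traj d t χ w (N + 1) ⬝ᵥ (Y (N + 1) *ᵥ S.traj d t χ w (N + 1)) =
        S.traj d t χ w N ⬝ᵥ (S.ric d (t + N) (Y (N + 1)) *ᵥ S.traj d t χ w N) +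
          S.deviation d t Y χ w N :=
      riccati_complete_square (h.posDef_Rt _) (hY _) _ _
    rw [← hrec N N.lt_succ_self] at hsq
    rw [Finset.sum_range_succ, Finset.sum_range_succ]
    linarith

end IsRegular

/-! ### The receding-horizon policy -/

/-- The costs-to-go `ℛ_{t+i} ∘ ⋯ ∘ ℛ_{t+T-1}(X)` of the problem with horizon `T` and terminal
penalty `X`. -/
noncomputable def costToGo (S : LQRData n m) (d T t : ℕ) (X : Matrix (Fin n) (Fin n) ℝ) (i : ℕ) :
    Matrix (Fin n) (Fin n) ℝ :=
  S.ricIter d (t + i) (T - i) X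

lemma costToGo_eq_ric (d : ℕ) {T t i : ℕ} (X : Matrix (Fin n) (Fin n) ℝ) (hi : i < T) :
    S.costToGo d T t X i = S.ric d (t + i) (S.costToGo d T t X (i + 1)) := by
  rw [costToGo, costToGo, show T - i = T - (i + 1) + 1 by omega, ricIter, add_assoc]

/-- The state under the feedback `w i = -K i x` applied from time `t` on. -/
noncomputable def feedbackState (S : LQRData n m) (d t : ℕ) (K : ℕ → Matrix (Fin d × Fin m) (Fin n) ℝ)
    (χ : Fin n → ℝ) : ℕ → Fin n → ℝ
  | 0 => χ
  | i + 1 => S.At d (t + i) *ᵥ feedbackState S d t K χ i +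
      S.Bt d (t + i) *ᵥ (-(K i *ᵥ feedbackState S d t K χ i))

lemma traj_eq_feedbackState (t : ℕ) (K : ℕ → Matrix (Fin d × Fin m) (Fin n) ℝ)
    (χ : Fin n → ℝ) {w : ℕ → Fin d × Fin m → ℝ} {i : ℕ}
    (hw : ∀ j < i, w j = -(K j *ᵥ S.feedbackState d t K χ j)) :
    S.traj d t χ w i = S.feedbackState d t K χ i := by
  induction i with
  | zero => rfl
  | succ i ih =>
    rw [traj, feedbackState, ih fun j hj => hw j (hj.trans i.lt_succ_self), hw i i.lt_succ_self]

lemma exists_feedback (T t : ℕ) (K : ℕ → Matrix (Fin d × Fin m) (Fin n) ℝ) (χ : Fin n → ℝ) :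
    ∃ w : Fin T → Fin d × Fin m → ℝ,
      ∀ i < T, extend w i = -(K i *ᵥ S.traj d t χ (extend w) i) := by
  refine ⟨fun i => -(K i *ᵥ S.feedbackState d t K χ i), fun i hi => ?_⟩
  rw [traj_eq_feedbackState t K χ fun j hj => by simp [extend, hj.trans hi]]
  simp [extend, hi]

namespace IsRegular

lemma isArgmin_iff (h : S.IsRegular d) {T t : ℕ} {χ : Fin n → ℝ} {X : Matrix (Fin n) (Fin n) ℝ}
    (hX : X.PosDef) {w : Fin T → Fin d × Fin m → ℝ} :
    S.IsArgmin d T t χ X w ↔ ∀ i < T, extend w i =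
      -(S.gain d (t + i) (S.costToGo d T t X (i + 1)) *ᵥ S.traj d t χ (extend w) i) := by
  have hY : ∀ i, (S.costToGo d T t X i).PosSemidef := fun i =>
    (h.ricIter_posDef _ _ hX).posSemidef
  have hval : ∀ w : Fin T → Fin d × Fin m → ℝ, S.costTerm d T t χ w X =
      χ ⬝ᵥ (S.costToGo d T t X 0 *ᵥ χ) +
        ∑ i ∈ Finset.range T, S.deviation d t (S.costToGo d T t X) χ (extend w) i := by
    intro w
    rw [← h.sum_stageCost_add t hY χ (extend w) T fun i hi => costToGo_eq_ric d X hi, costTerm,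
      cost_eq_sum, costToGo, Nat.sub_self, ricIter]
  have hnn : ∀ w : Fin T → Fin d × Fin m → ℝ, ∀ i ∈ Finset.range T,
      0 ≤ S.deviation d t (S.costToGo d T t X) χ (extend w) i := fun w i _ =>
    h.deviation_nonneg t hY χ _ i
  constructor
  · intro hw i hi
    obtain ⟨w₀, hw₀⟩ := exists_feedback (S := S) T t
      (fun i => S.gain d (t + i) (S.costToGo d T t X (i + 1))) χ
    have hle := hw w₀
    rw [hval, hval, Finset.sum_eq_zero fun i hi => deviation_of_eq (hw₀ i (Finset.mem_range.1 hi))]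
      at hle
    have hsum := (Finset.sum_nonneg (hnn w)).antisymm' (by linarith)
    exact h.eq_of_deviation_eq_zero hY
      ((Finset.sum_eq_zero_iff_of_nonneg (hnn w)).1 hsum i (Finset.mem_range.2 hi))
  · intro hw w'
    rw [hval, hval, Finset.sum_eq_zero fun i hi => deviation_of_eq (hw i (Finset.mem_range.1 hi))]
    linarith [Finset.sum_nonneg (hnn w')]

lemma existsUnique_isArgmin (h : S.IsRegular d) (T t : ℕ) (χ : Fin n → ℝ)
    {X : Matrix (Fin n) (Fin n) ℝ} (hX : X.PosDef) :
    ∃! w : Fin T → Fin d × Fin m → ℝ, S.IsArgmin d T t χ X w := by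
  obtain ⟨w, hw⟩ := exists_feedback (S := S) T t
    (fun i => S.gain d (t + i) (S.costToGo d T t X (i + 1))) χ
  refine ⟨w, (h.isArgmin_iff hX).2 hw, fun w' hw' => ?_⟩
  have hw' := (h.isArgmin_iff hX).1 hw'
  have key : ∀ i, i < T → extend w' i = extend w i := by
    intro i
    induction i using Nat.strong_induction_on with
    | _ i ih =>
      intro hi
      rw [hw i hi, hw' i hi, traj_congr fun j hj => ih j hj (hj.trans hi)]
  funext i
  rw [← extend_apply w', ← extend_apply w, key i i.2]

lemma isRHPolicy_eq (h : S.IsRegular d) {T : ℕ} (hT : 1 ≤ T)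
    {μ : ℕ → (Fin n → ℝ) → Fin d × Fin m → ℝ} (hμ : S.IsRHPolicy d T (S.termPen d) μ)
    (t : ℕ) (x : Fin n → ℝ) : μ t x = -(S.gain d t (S.XhatSucc d T t) *ᵥ x) := by
  obtain ⟨w, hw, hμw⟩ := hμ t x
  rw [hμw, (h.isArgmin_iff (h.termPen_posDef _)).1 hw 0 hT]
  rfl

end IsRegular

/-! ### Infinite-horizon costs -/

lemma traj_clInput (μ : ℕ → (Fin n → ℝ) → Fin d × Fin m → ℝ) (ξ : Fin n → ℝ) (i : ℕ) :
    S.traj d 0 ξ (S.clInput d μ ξ) i = S.clState d μ ξ i := by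
  induction i with
  | zero => rfl
  | succ i ih => rw [traj, ih, zero_add]; rfl

namespace IsRegular

lemma monotone_partialCost (h : S.IsRegular d) (ξ : Fin n → ℝ) (u : ℕ → Fin d × Fin m → ℝ) :
    Monotone (S.partialCost d 0 ξ u) := by
  refine monotone_nat_of_le_succ fun N => ?_
  rw [partialCost_eq_sum, partialCost_eq_sum, Finset.sum_range_succ]
  exact le_add_of_nonneg_right (h.stageCost_nonneg _ _ _ _)

lemma tendsto_partialCost_of_le (h : S.IsRegular d) {ξ : Fin n → ℝ} {u : ℕ → Fin d × Fin m → ℝ}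
    {c : ℝ} (hc : ∀ N, S.partialCost d 0 ξ u N ≤ c) :
    Tendsto (S.partialCost d 0 ξ u) atTop (𝓝 (S.infCost d 0 ξ u)) ∧ S.infCost d 0 ξ u ≤ c := by
  have hlim := tendsto_atTop_ciSup (h.monotone_partialCost ξ u) ⟨c, by rintro _ ⟨N, rfl⟩; exact hc N⟩
  have e : S.infCost d 0 ξ u = _ := hlim.limUnder_eq
  rw [← e] at hlim
  exact ⟨hlim, le_of_tendsto' hlim hc⟩

/-- Bounded cost drives the state to zero, also when weighted by a bounded cost-to-go. -/
lemma tendsto_quad_traj (h : S.IsRegular d) {ξ : Fin n → ℝ} {u : ℕ → Fin d × Fin m → ℝ} {c : ℝ}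
    (hc : ∀ N, S.partialCost d 0 ξ u N ≤ c) {P : ℕ → Matrix (Fin n) (Fin n) ℝ}
    (hP : ∀ t, (P t).PosSemidef) (hb : BddAbove (range fun t => ‖P t‖)) :
    Tendsto (fun i => S.traj d 0 ξ u i ⬝ᵥ (P i *ᵥ S.traj d 0 ξ u i)) atTop (𝓝 0) := by
  obtain ⟨q, hq0, hq⟩ := h.exists_le_Qt
  obtain ⟨b, hb⟩ := hb
  have hsum : Summable (S.stageCost d 0 ξ u) :=
    summable_of_sum_range_le (h.stageCost_nonneg 0 ξ u) fun N => by
      rw [← partialCost_eq_sum]; exact hc N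
  have hlim := (hsum.tendsto_atTop_zero).const_mul (b / q)
  rw [mul_zero] at hlim
  refine squeeze_zero (fun i => (hP i).quad_nonneg _) (fun i => ?_) hlim
  have h1 : ‖P i‖ ≤ b := hb ⟨i, rfl⟩
  have hb0 : 0 ≤ b := (norm_nonneg _).trans h1
  set z := S.traj d 0 ξ u i with hz
  have h2 : q * (z ⬝ᵥ z) ≤ S.stageCost d 0 ξ u i :=
    (hq _ z).trans (le_add_of_nonneg_right ((h.posDef_Rt _).posSemidef.quad_nonneg _))
  calc z ⬝ᵥ (P i *ᵥ z) ≤ b * (z ⬝ᵥ z) :=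
        (quad_le_norm _ z).trans (mul_le_mul_of_nonneg_right h1 (dotProduct_self_nonneg' z))
    _ = b / q * (q * (z ⬝ᵥ z)) := by field_simp
    _ ≤ _ := mul_le_mul_of_nonneg_left h2 (by positivity)

lemma partialCost_add (h : S.IsRegular d) {P : ℕ → Matrix (Fin n) (Fin n) ℝ}
    (hP : S.IsRiccatiSolution d P) (ξ : Fin n → ℝ) (u : ℕ → Fin d × Fin m → ℝ) (N : ℕ) :
    S.partialCost d 0 ξ u N + S.traj d 0 ξ u N ⬝ᵥ (P N *ᵥ S.traj d 0 ξ u N) =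
      ξ ⬝ᵥ (P 0 *ᵥ ξ) + ∑ i ∈ Finset.range N, S.deviation d 0 P ξ u i := by
  rw [partialCost_eq_sum]
  exact h.sum_stageCost_add 0 hP.1 ξ u N fun i _ => by rw [zero_add]; exact hP.2.2 i

lemma le_of_tendsto_partialCost (h : S.IsRegular d) {P : ℕ → Matrix (Fin n) (Fin n) ℝ}
    (hP : S.IsRiccatiSolution d P) {ξ : Fin n → ℝ} {u : ℕ → Fin d × Fin m → ℝ} {c : ℝ}
    (hc : Tendsto (S.partialCost d 0 ξ u) atTop (𝓝 c)) : ξ ⬝ᵥ (P 0 *ᵥ ξ) ≤ c := by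
  have hz := h.tendsto_quad_traj ((h.monotone_partialCost ξ u).ge_of_tendsto hc) hP.1 hP.2.1
  have hlim := hc.add hz
  rw [add_zero] at hlim
  refine ge_of_tendsto' hlim fun N => ?_
  rw [h.partialCost_add hP]
  exact le_add_of_nonneg_right
    (Finset.sum_nonneg fun i _ => h.deviation_nonneg 0 hP.1 ξ u i)

lemma partialCost_optPolicy_le (h : S.IsRegular d) {P : ℕ → Matrix (Fin n) (Fin n) ℝ}
    (hP : S.IsRiccatiSolution d P) (ξ : Fin n → ℝ) (N : ℕ) :
    S.partialCost d 0 ξ (S.clInput d (S.optPolicy d P) ξ) N ≤ ξ ⬝ᵥ (P 0 *ᵥ ξ) := by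
  have hsum := h.partialCost_add hP ξ (S.clInput d (S.optPolicy d P) ξ) N
  rw [Finset.sum_eq_zero fun i _ => deviation_of_eq (by rw [traj_clInput, zero_add]; rfl),
    add_zero] at hsum
  rw [← hsum]
  exact le_add_of_nonneg_right ((hP.1 N).quad_nonneg _)

lemma XhatSucc_posDef (h : S.IsRegular d) (T t : ℕ) : (S.XhatSucc d T t).PosDef :=
  h.ricIter_posDef _ _ (h.termPen_posDef _)

/-- Along the receding-horizon policy `x' ℛ_t(X̂_{t+1}) x` decreases by at least the stage cost,
because `ℛ_{t+1}(X̂_{t+2}) ≤ X̂_{t+1}`. -/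
lemma partialCost_rhPolicy_le (h : S.IsRegular d) {T : ℕ} (hT : 1 ≤ T)
    {μ : ℕ → (Fin n → ℝ) → Fin d × Fin m → ℝ} (hμ : S.IsRHPolicy d T (S.termPen d) μ)
    (ξ : Fin n → ℝ) (N : ℕ) :
    S.partialCost d 0 ξ (S.clInput d μ ξ) N ≤ ξ ⬝ᵥ (S.ric d 0 (S.XhatSucc d T 0) *ᵥ ξ) := by
  have hX := h.XhatSucc_posDef T
  set z := S.clState d μ ξ with hz
  have hdec : ∀ t, S.ric d (t + 1) (S.XhatSucc d T (t + 1)) ≤ S.XhatSucc d T t := by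
    intro t
    obtain ⟨T, rfl⟩ : ∃ T', T = T' + 1 := ⟨T - 1, by omega⟩
    have := h.ricIter_succ_termPen_le (t + 1) T
    rwa [ricIter, show t + 1 + T = t + (T + 1) by omega] at this
  have key : S.partialCost d 0 ξ (S.clInput d μ ξ) N +
      z N ⬝ᵥ (S.ric d N (S.XhatSucc d T N) *ᵥ z N) ≤
        ξ ⬝ᵥ (S.ric d 0 (S.XhatSucc d T 0) *ᵥ ξ) := by
    induction N with
    | zero => rw [partialCost_eq_sum]; simp [hz, clState]
    | succ N ih =>
      refine le_trans ?_ ih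
      rw [partialCost_eq_sum, Finset.sum_range_succ, ← partialCost_eq_sum, add_assoc]
      refine add_le_add le_rfl ?_
      have hu : S.clInput d μ ξ N = -(S.gain d N (S.XhatSucc d T N) *ᵥ z N) :=
        h.isRHPolicy_eq hT hμ N _
      have hsq : z N ⬝ᵥ (S.ric d N (S.XhatSucc d T N) *ᵥ z N) = _ :=
        riccati_quad_eq (h.posDef_Rt N) (hX N).posSemidef (z N)
      have hznext : z (N + 1) = S.At d N *ᵥ z N +
          S.Bt d N *ᵥ (-(S.gain d N (S.XhatSucc d T N) *ᵥ z N)) := by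
        rw [← hu]; rfl
      rw [hsq, stageCost, traj_clInput, zero_add, hu]
      refine add_le_add le_rfl ((quad_mono (hdec N) _).trans_eq ?_)
      rw [hznext]
      rfl
  have := (h.ric_posDef N (hX N).posSemidef).posSemidef.quad_nonneg (z N)
  linarith

end IsRegular

/-! ### The constants of the bound -/

namespace IsRegular

lemma bddAbove_norm_ric (h : S.IsRegular d) (T : ℕ) :
    BddAbove (range fun t => ‖S.ric d t (S.XhatSucc d T t)‖) := by
  have hX := fun t => (h.XhatSucc_posDef T t).posSemidef
  obtain ⟨c, hc⟩ := UniformlyBounded.of_quad_le (fun t => (h.ric_posDef t (hX t)).posSemidef)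
    h.bounded_termPen fun t x => quad_mono (h.ric_le_termPen t (hX t)) x
  exact ⟨c, by rintro _ ⟨t, rfl⟩; exact hc t⟩

lemma omegaSup_pos (hn : 0 < n) (h : S.IsRegular d) (T : ℕ) : 0 < S.omegaSup d T := by
  have : Nonempty (Fin n) := ⟨⟨0, hn⟩⟩
  exact (h.ric_posDef 0 (h.XhatSucc_posDef T 0).posSemidef).norm_pos.trans_le
    (le_ciSup (h.bddAbove_norm_ric T) 0)

/-- Matrices above `Q̃_t` have least eigenvalues bounded away from zero. -/
lemma exists_le_lambdaMin (hn : 0 < n) (h : S.IsRegular d) : ∃ q, 0 < q ∧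
    ∀ t (M : Matrix (Fin n) (Fin n) ℝ), S.Qt d t ≤ M → q ≤ lambdaMin M := by
  have : Nonempty (Fin n) := ⟨⟨0, hn⟩⟩
  obtain ⟨q, hq0, hq⟩ := h.exists_le_Qt
  exact ⟨q, hq0, fun t M hM => le_lambdaMin fun x => (hq t x).trans (quad_mono hM x)⟩

/-- Common source of the bounds on `ω̲` and `λ̲`, both of which are infima of least eigenvalues of
matrices above `Q̃_t`. -/
lemma iInf_lambdaMin_pos_and_le (hn : 0 < n) (h : S.IsRegular d)
    {M : ℕ → Matrix (Fin n) (Fin n) ℝ} (hM : ∀ t, S.Qt d t ≤ M t) :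
    (0 < ⨅ t, lambdaMin (M t)) ∧
      ∀ c, (∀ x, x ⬝ᵥ (M 0 *ᵥ x) ≤ c * (x ⬝ᵥ x)) → ⨅ t, lambdaMin (M t) ≤ c := by
  obtain ⟨q, hq0, hq⟩ := h.exists_le_lambdaMin hn
  refine ⟨hq0.trans_le (le_ciInf fun t => hq t _ (hM t)), fun c hc => ?_⟩
  refine (ciInf_le ⟨q, by rintro _ ⟨t, rfl⟩; exact hq t _ (hM t)⟩ 0).trans ?_
  have h1 := (lambdaMin_mul_le (M 0) (Pi.single ⟨0, hn⟩ 1)).trans (hc _)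
  simpa using h1

lemma Qt_le_ric_XhatSucc (h : S.IsRegular d) (T t : ℕ) :
    S.Qt d t ≤ S.ric d t (S.XhatSucc d T t) :=
  h.le_ric t (h.XhatSucc_posDef T t).posSemidef

lemma ric_XhatSucc_quad_le (h : S.IsRegular d) (T t : ℕ) (x : Fin n → ℝ) :
    x ⬝ᵥ (S.ric d t (S.XhatSucc d T t) *ᵥ x) ≤ S.omegaSup d T * (x ⬝ᵥ x) :=
  (quad_le_norm _ x).trans (mul_le_mul_of_nonneg_right (le_ciSup (h.bddAbove_norm_ric T) t)
    (dotProduct_self_nonneg' x))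

lemma Qt_le_add_gain (h : S.IsRegular d) (T t : ℕ) :
    S.Qt d t ≤ S.Qt d t + (S.gain d t (S.XhatSucc d T t))ᵀ * S.Rt d t *
      S.gain d t (S.XhatSucc d T t) :=
  le_add_of_nonneg_right (posSemidef_conj (h.posDef_Rt t).posSemidef _).nonneg

lemma omegaInf_pos (hn : 0 < n) (h : S.IsRegular d) (T : ℕ) : 0 < S.omegaInf d T :=
  (h.iInf_lambdaMin_pos_and_le hn (h.Qt_le_ric_XhatSucc T)).1

lemma omegaInf_le_omegaSup (hn : 0 < n) (h : S.IsRegular d) (T : ℕ) :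
    S.omegaInf d T ≤ S.omegaSup d T :=
  (h.iInf_lambdaMin_pos_and_le hn (h.Qt_le_ric_XhatSucc T)).2 _ (h.ric_XhatSucc_quad_le T 0)

lemma lamInf_pos (hn : 0 < n) (h : S.IsRegular d) (T : ℕ) : 0 < S.lamInf d T :=
  (h.iInf_lambdaMin_pos_and_le hn (h.Qt_le_add_gain T)).1

lemma lamInf_le_omegaSup (hn : 0 < n) (h : S.IsRegular d) (T : ℕ) :
    S.lamInf d T ≤ S.omegaSup d T := by
  refine (h.iInf_lambdaMin_pos_and_le hn (h.Qt_le_add_gain T)).2 _ fun x => ?_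
  refine le_trans ?_ (h.ric_XhatSucc_quad_le T 0 x)
  have hX := (h.XhatSucc_posDef T 0).posSemidef
  have hsq : x ⬝ᵥ (S.ric d 0 (S.XhatSucc d T 0) *ᵥ x) = _ :=
    riccati_quad_eq (h.posDef_Rt 0) hX x
  rw [hsq, add_mulVec, dotProduct_add, quad_conj]
  simp only [mulVec_neg, neg_dotProduct, dotProduct_neg, neg_neg]
  exact le_add_of_nonneg_right (hX.quad_nonneg _)

lemma lamSup_pos (hn : 0 < n) (h : S.IsRegular d) {P : ℕ → Matrix (Fin n) (Fin n) ℝ}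
    (hP : S.IsRiccatiSolution d P) : 0 < lamSup P := by
  have : Nonempty (Fin n) := ⟨⟨0, hn⟩⟩
  exact (h.posDef_of_isRiccatiSolution hP 0).norm_pos.trans_le (le_ciSup hP.2.1 0)

lemma lambdaMin_pos (hn : 0 < n) (h : S.IsRegular d) {P : ℕ → Matrix (Fin n) (Fin n) ℝ}
    (hP : S.IsRiccatiSolution d P) (t : ℕ) : 0 < lambdaMin (P t) := by
  obtain ⟨q, hq0, hq⟩ := h.exists_le_lambdaMin hn
  exact hq0.trans_le (hq t _ (h.Qt_le_of_isRiccatiSolution hP t))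

lemma bddAbove_deltaRatio (hn : 0 < n) (h : S.IsRegular d) (T : ℕ)
    {P : ℕ → Matrix (Fin n) (Fin n) ℝ} (hP : S.IsRiccatiSolution d P) :
    BddAbove (range (S.deltaRatio d T P)) := by
  obtain ⟨q, hq0, hq⟩ := h.exists_le_lambdaMin hn
  obtain ⟨c, hc0, hc⟩ := h.bounded_termPen.exists_pos
  refine ⟨c / q, ?_⟩
  rintro _ ⟨t, rfl⟩
  exact div_le_div₀ hc0.le (hc _) hq0 (hq _ _ (h.Qt_le_of_isRiccatiSolution hP _))

lemma one_lt_iSup_deltaRatio (hn : 0 < n) (h : S.IsRegular d) (T : ℕ)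
    {P : ℕ → Matrix (Fin n) (Fin n) ℝ} (hP : S.IsRiccatiSolution d P) :
    1 < ⨆ t, S.deltaRatio d T P t := by
  refine lt_of_lt_of_le ?_ (le_ciSup (h.bddAbove_deltaRatio hn T hP) 0)
  rw [deltaRatio, one_lt_div (h.lambdaMin_pos hn hP _)]
  set e : Fin n → ℝ := Pi.single ⟨0, hn⟩ 1 with he
  have he1 : e ⬝ᵥ e = 1 := by simp [he]
  have he0 : e ≠ 0 := fun h0 => by rw [h0] at he1; simp at he1
  have h1 := lambdaMin_mul_le (P (0 + T)) e
  have h2 : e ⬝ᵥ (S.ric d (0 + T) (P (0 + T + 1)) *ᵥ e) < e ⬝ᵥ (S.termPen d (0 + T) *ᵥ e) := by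
    rw [termPen_eq]
    exact riccati_quad_lt_deadbeat (h.posDef_Rt _) (hP.1 _) (h.posDef_Bt _) (h.isUnit_At _) he0
  have h3 := quad_le_norm (S.termPen d (0 + T)) e
  rw [← hP.2.2] at h2
  rw [he1, mul_one] at h1 h3
  linarith

lemma termPen_le_exp_smul (hn : 0 < n) (h : S.IsRegular d) (T : ℕ)
    {P : ℕ → Matrix (Fin n) (Fin n) ℝ} (hP : S.IsRiccatiSolution d P) (t : ℕ) :
    S.termPen d (t + T) ≤ Real.exp (Real.log (⨆ t, S.deltaRatio d T P t)) • P (t + T) := by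
  have hpos := h.lambdaMin_pos hn hP (t + T)
  refine le_of_quad (h.termPen_posDef _).isHermitian (isHermitian_smul (hP.1 _).isHermitian _)
    fun x => ?_
  rw [quad_smul, Real.exp_log (zero_lt_one.trans (h.one_lt_iSup_deltaRatio hn T hP))]
  calc x ⬝ᵥ (S.termPen d (t + T) *ᵥ x) ≤ ‖S.termPen d (t + T)‖ * (x ⬝ᵥ x) := quad_le_norm _ x
    _ = S.deltaRatio d T P t * (lambdaMin (P (t + T)) * (x ⬝ᵥ x)) := by
        rw [deltaRatio]; field_simp
    _ ≤ S.deltaRatio d T P t * (x ⬝ᵥ (P (t + T) *ᵥ x)) :=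
        mul_le_mul_of_nonneg_left (lambdaMin_mul_le _ x) (div_nonneg (norm_nonneg _) hpos.le)
    _ ≤ _ := mul_le_mul_of_nonneg_right (le_ciSup (h.bddAbove_deltaRatio hn T hP) t)
        ((hP.1 _).quad_nonneg x)

lemma deltaSup_pos (hn : 0 < n) (h : S.IsRegular d) (T : ℕ)
    {P : ℕ → Matrix (Fin n) (Fin n) ℝ} (hP : S.IsRiccatiSolution d P) :
    0 < S.deltaSup d T P :=
  mul_pos (Real.sqrt_pos.2 (Nat.cast_pos.2 hn)) (Real.log_pos (h.one_lt_iSup_deltaRatio hn T hP))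

/-- Contracting the distance between `X_T` and `P_T` over `T` steps compares the value
`ℛ_0(X̂_1)` that bounds the cost of the receding-horizon policy with the optimal value `P_0`. -/
lemma ric_XhatSucc_le_exp_smul (hn : 0 < n) (h : S.IsRegular d) {T : ℕ} (hT : 1 ≤ T)
    {P : ℕ → Matrix (Fin n) (Fin n) ℝ} (hP : S.IsRiccatiSolution d P) (x : Fin n → ℝ) :
    x ⬝ᵥ (S.ric d 0 (S.XhatSucc d T 0) *ᵥ x) ≤
      Real.exp ((S.zetaSup d / (S.zetaSup d + S.epsInf d)) ^ (T - 1) * S.deltaSup d T P) *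
        (x ⬝ᵥ (P 0 *ᵥ x)) := by
  set δ := Real.log (⨆ t, S.deltaRatio d T P t) with hδ
  have hδ0 : 0 < δ := Real.log_pos (h.one_lt_iSup_deltaRatio hn T hP)
  have hc := h.ricIter_le_exp_smul hn T 0 (h.posDef_of_isRiccatiSolution hP (0 + T))
    (h.termPen_posDef (0 + T)) hδ0.le (h.termPen_le_exp_smul hn T hP 0)
  rw [← hP.eq_ricIter] at hc
  have hx := quad_mono hc x
  rw [quad_smul] at hx
  have e : S.ricIter d 0 T (S.termPen d (0 + T)) = S.ric d 0 (S.XhatSucc d T 0) := by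
    obtain ⟨T, rfl⟩ : ∃ T', T = T' + 1 := ⟨T - 1, by omega⟩
    rfl
  rw [e] at hx
  refine hx.trans (mul_le_mul_of_nonneg_right (Real.exp_le_exp.2 ?_) ((hP.1 0).quad_nonneg x))
  have hsqrt : δ ≤ S.deltaSup d T P :=
    le_mul_of_one_le_left hδ0.le (Real.one_le_sqrt.2 (Nat.one_le_cast.2 hn))
  exact mul_le_mul (pow_le_pow_of_le_one (h.rate_nonneg hn) (h.rate_lt_one hn).le (Nat.sub_le T 1))
    hsqrt hδ0.le (pow_nonneg (h.rate_nonneg hn) _)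

end IsRegular

end LQRData

/-! ### The performance bound -/

theorem theorem5 {n m d : ℕ} (hn : 0 < n) (hm : 0 < m) (hd : 0 < d) (S : LQRData n m)
    (hQ : ∀ k, (S.Q k).PosSemidef) (hR : ∀ k, (S.R k).PosDef)
    (hbdd : S.IsBounded) (hA : ∀ k, IsUnit (S.A k))
    (hco : S.IsCtrObs d) (hunif : S.IsUniform d)
    (T : ℕ) (hT : 1 ≤ T) :
    -- the bounded positive semidefinite solution of the Riccati recursion is well defined
    (∃! P : ℕ → Matrix (Fin n) (Fin n) ℝ, S.IsRiccatiSolution d P) ∧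
    -- the receding-horizon policy is well defined
    (∀ t, (S.termPen d (t + T)).PosDef) ∧
    (∀ t χ, ∃! w : Fin T → Fin d × Fin m → ℝ, S.IsArgmin d T t χ (S.termPen d (t + T)) w) ∧
    -- the contraction constants
    (∀ t, 0 < S.zeta d t) ∧ (∀ t, 0 < S.eps d t) ∧
    BddAbove (range (S.zeta d)) ∧ 0 < S.zetaSup d ∧ 0 < S.epsInf d ∧
    S.zetaSup d / (S.zetaSup d + S.epsInf d) < 1 ∧
    -- the constants attached to the horizon `T`
    BddAbove (range fun t => ‖S.ric d t (S.XhatSucc d T t)‖) ∧ 0 < S.omegaSup d T ∧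
    0 < S.omegaInf d T ∧ 0 < S.lamInf d T ∧
    ∀ P : ℕ → Matrix (Fin n) (Fin n) ℝ, S.IsRiccatiSolution d P →
      0 < LQRData.lamSup P ∧
      BddAbove (range (S.deltaRatio d T P)) ∧ 0 < S.deltaSup d T P ∧
      ∀ μ : ℕ → (Fin n → ℝ) → Fin d × Fin m → ℝ, S.IsRHPolicy d T (S.termPen d) μ →
        ∀ ξ : Fin n → ℝ,
          -- both infinite-horizon costs are finite, and the reference input is optimal
          Tendsto (S.partialCost d 0 ξ (S.clInput d μ ξ)) atTop
            (𝓝 (S.infCost d 0 ξ (S.clInput d μ ξ))) ∧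
          Tendsto (S.partialCost d 0 ξ (S.clInput d (S.optPolicy d P) ξ)) atTop
            (𝓝 (S.infCost d 0 ξ (S.clInput d (S.optPolicy d P) ξ))) ∧
          (∀ (u : ℕ → Fin d × Fin m → ℝ) (c : ℝ),
            Tendsto (S.partialCost d 0 ξ u) atTop (𝓝 c) →
              S.infCost d 0 ξ (S.clInput d (S.optPolicy d P) ξ) ≤ c) ∧
          -- the performance bound
          S.perfLoss d P μ ξ ≤
            LQRData.lamSup P / S.lamInf d T * (S.omegaSup d T / S.omegaInf d T) * S.omegaSup d T
              * (Real.exp ((S.zetaSup d / (S.zetaSup d + S.epsInf d)) ^ (T - 1) * S.deltaSup d T P)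
                  - 1)
              * (ξ ⬝ᵥ ξ) := by
  have h : S.IsRegular d := LQRData.isRegular hQ hR hbdd hA hunif
  refine ⟨h.existsUnique_isRiccatiSolution hn, fun t => h.termPen_posDef _,
    fun t χ => h.existsUnique_isArgmin T t χ (h.termPen_posDef _), h.zeta_pos hn,
    fun t => (h.epsInf_pos hn).trans_le (h.epsInf_le hn t), h.bddAbove_zeta, h.zetaSup_pos hn,
    h.epsInf_pos hn, h.rate_lt_one hn, h.bddAbove_norm_ric T, h.omegaSup_pos hn T,
    h.omegaInf_pos hn T, h.lamInf_pos hn T, fun P hP => ⟨h.lamSup_pos hn hP,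
    h.bddAbove_deltaRatio hn T hP, h.deltaSup_pos hn T hP, fun μ hμ ξ => ?_⟩⟩
  obtain ⟨hrh, hrh_le⟩ := h.tendsto_partialCost_of_le (h.partialCost_rhPolicy_le hT hμ ξ)
  obtain ⟨hopt, hopt_le⟩ := h.tendsto_partialCost_of_le (h.partialCost_optPolicy_le hP ξ)
  have hopt_ge := h.le_of_tendsto_partialCost hP hopt
  refine ⟨hrh, hopt, fun u c hc => hopt_le.trans (h.le_of_tendsto_partialCost hP hc), ?_⟩
  have hexp := h.ric_XhatSucc_le_exp_smul hn hT hP ξ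
  set r := (S.zetaSup d / (S.zetaSup d + S.epsInf d)) ^ (T - 1) * S.deltaSup d T P with hr
  have hr0 : 0 ≤ r := mul_nonneg (pow_nonneg (h.rate_nonneg hn) _) (h.deltaSup_pos hn T hP).le
  have hr1 : 0 ≤ Real.exp r - 1 := sub_nonneg.2 (Real.one_le_exp hr0)
  have hξ := dotProduct_self_nonneg' ξ
  have hlam : ξ ⬝ᵥ (P 0 *ᵥ ξ) ≤ LQRData.lamSup P * (ξ ⬝ᵥ ξ) :=
    (quad_le_norm _ ξ).trans (mul_le_mul_of_nonneg_right (le_ciSup hP.2.1 0) hξ)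
  -- the remaining factors of the bound are at least `1`
  have hconst : LQRData.lamSup P ≤
      LQRData.lamSup P / S.lamInf d T * (S.omegaSup d T / S.omegaInf d T) * S.omegaSup d T := by
    have h1 : 1 ≤ S.omegaSup d T / S.lamInf d T :=
      (one_le_div (h.lamInf_pos hn T)).2 (h.lamInf_le_omegaSup hn T)
    have h2 : 1 ≤ S.omegaSup d T / S.omegaInf d T :=
      (one_le_div (h.omegaInf_pos hn T)).2 (h.omegaInf_le_omegaSup hn T)
    calc LQRData.lamSup P = LQRData.lamSup P * (1 * 1) := by ring
      _ ≤ LQRData.lamSup P *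
          (S.omegaSup d T / S.lamInf d T * (S.omegaSup d T / S.omegaInf d T)) :=
          mul_le_mul_of_nonneg_left (mul_le_mul h1 h2 zero_le_one (zero_le_one.trans h1))
            (h.lamSup_pos hn hP).le
      _ = _ := by ring
  calc S.perfLoss d P μ ξ ≤ Real.exp r * (ξ ⬝ᵥ (P 0 *ᵥ ξ)) - ξ ⬝ᵥ (P 0 *ᵥ ξ) :=
        sub_le_sub (hrh_le.trans hexp) hopt_ge
    _ = (Real.exp r - 1) * (ξ ⬝ᵥ (P 0 *ᵥ ξ)) := by ring
    _ ≤ (Real.exp r - 1) * (LQRData.lamSup P * (ξ ⬝ᵥ ξ)) := mul_le_mul_of_nonneg_left hlam hr1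
    _ = LQRData.lamSup P * (Real.exp r - 1) * (ξ ⬝ᵥ ξ) := by ring
    _ ≤ _ := mul_le_mul_of_nonneg_right (mul_le_mul_of_nonneg_right hconst hr1) hξ
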